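/- Let $\alpha>0$, $\sigma\in\mathbb R$, and let $m=m_n$ be positive integers (for large $n$) with $m_n/n\to\alpha$. Put $\mathcal X_n=\{-1/\sqrt n,1/\sqrt n\}^n$ and let $x_{sol}=x_{sol}^{(n)}\in\mathcal X_n$ be arbitrary. Let $A\in\mathbb R^{m\times n}$ and $v\in\mathbb R^m$ have i.i.d. standard normal entries. For a real sequence $c=(c^{(n)})$ define $$\xi_p^{(ml)}(\alpha,\sigma;c)=\liminf_{n\to\infty}\frac1{\sqrt n}\,\mathbb E\min_{x\in\mathcal X_n}\ \max_{\|\lambda\|_2=1,\ \nu\in\mathbb R}\Big(\lambda^T\big(A(x_{sol}-x)+\sigma v\big)+\nu\,(x_{sol}^Tx-c^{(n)})\Big)\in(-\infty,+\infty],$$ where the inner value is $\min\{\|A(x_{sol}-x)+\sigma v\|_2 : x\in\mathcal X_n,\ x_{sol}^Tx=c^{(n)}\}$, read as $+\infty$ if no such $x$ exists; write $\xi_p^{(ml)}(\alpha,\sigma;c_1)$ for the constant sequence $c^{(n)}=c_1$. With independent standard normal vectors $g\in\mathbb R^m$, $h\in\mathbb R^n$ and a standard normal variable $h_0$, for $c_1\in[-1,1]$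 and $\nu\in\mathbb R$ let $$\xi_{RD}^{(ml)}(\alpha,\sigma;c_1,\nu)=\lim_{n\to\infty}\frac1{\sqrt n}\,\mathbb E\min_{x\in\mathcal X_n}\max_{\|\lambda\|_2=1}\Big(\lambda^Tg\sqrt{2-2c_1+\sigma^2}-\|\lambda\|_2\big(h^T(x_{sol}-x)+h_0\sigma\big)+\sqrt n\,\nu\,(x_{sol}^Tx-c_1)\Big).$$ This limit exists and, with $Z$ standard normal, $$\xi_{RD}^{(ml)}(\alpha,\sigma;c_1,\nu)=\sqrt\alpha\sqrt{2-2c_1+\sigma^2}-\mathbb E|Z+\nu|-\nu c_1 .$$ Let $$B(c_1)=\sqrt{\alpha}\sqrt{2-2c_1+\sigma^2}-\sqrt{\tfrac2\pi}\,\exp\!\Big(-\tfrac{(\sqrt2\,\mathrm{erfinv}(-c_1))^2}{2}\Big),$$ where $\mathrm{erfinv}(\pm1)=\pm\infty$ and $\exp(-\infty)=0$. Then for every $c_1\in[-1,1]$ $$\xi_p^{(ml)}(\alpha,\sigma;c_1)\ \ge\ \max_{\nu}\ \xi_{RD}^{(ml)}(\alpha,\sigma;c_1,\nu)=B(c_1),$$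 the maximum being attained for $|c_1|<1$ and being a supremum for $c_1=\pm1$. More generally $\xi_p^{(ml)}(\alpha,\sigma;c)\ge B(c_1)$ for every real sequence $c^{(n)}\to c_1$. If in the random dual the number $2-2c_1$ is replaced by $\|x_{sol}-x\|_2^2$ inside the minimum over $x$, then the upper limit of the corresponding normalized expectations is, for every $\nu$, at most $B(c_1)$, hence also at most $\xi_p^{(ml)}(\alpha,\sigma;c_1)$. Consequently, $B$ attains its minimum over $[-1,1]$ and $$\inf_{c_1\in[-1,1]}\xi_p^{(ml)}(\alpha,\sigma;c_1)\ \ge\ \min_{c_1\in[-1,1]}\max_\nu\xi_{RD}^{(ml)}(\alpha,\sigma;c_1,\nu)=\min_{c_1\in[-1,1]}B(c_1).$$ -/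

import Mathlib

open MeasureTheory ProbabilityTheory Filter Topology Matrix

noncomputable section

namespace MLDetection

/-- The binary alphabet `{-1/√n, 1/√n}^n`. -/
def binarySet (n : ℕ) : Set (EuclideanSpace ℝ (Fin n)) :=
  {x | ∀ i, x i = 1 / √(n : ℝ) ∨ x i = -(1 / √(n : ℝ))}

/-- Law of a vector in `ℝ^k` with i.i.d. standard normal entries. -/
def gaussVec (k : ℕ) : Measure (Fin k → ℝ) :=
  Measure.pi fun _ => gaussianReal 0 1

/-- Law of an `m × n` matrix with i.i.d. standard normal entries. -/
def gaussMat (m n : ℕ) : Measure (Fin m → Fin n → ℝ) :=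
  Measure.pi fun _ => Measure.pi fun _ => gaussianReal 0 1

/-- Expectation `E f⁺ - E f⁻` of an extended-real random variable. -/
def expect {Ω : Type*} [MeasurableSpace Ω] (μ : Measure Ω) (f : Ω → EReal) : EReal :=
  ((∫⁻ ω, (f ω).toENNReal ∂μ : ENNReal) : EReal) -
    ((∫⁻ ω, (-f ω).toENNReal ∂μ : ENNReal) : EReal)

/-- The Lagrangian objective
`min_{x ∈ X} max_{‖λ‖ = 1, ν} λᵀ[A v][s - x; σ] + ν (sᵀx - c)`.
Because of the maximum over all real `ν` the value is `+∞` when no `x` has overlap `c` with `s`,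
and otherwise it is the minimum of `‖A (s - x) + σ v‖₂` over the `x` with overlap `c`. -/
def primalObj {m n : ℕ} (σ : ℝ) (s : EuclideanSpace ℝ (Fin n)) (c : ℝ)
    (A : Fin m → Fin n → ℝ) (v : Fin m → ℝ) : EReal :=
  ⨅ x ∈ binarySet n, ⨆ l ∈ Metric.sphere (0 : EuclideanSpace ℝ (Fin m)) 1, ⨆ ν : ℝ,
    ((l.ofLp ⬝ᵥ (Matrix.of A *ᵥ (s - x).ofLp + σ • v) + ν * (inner ℝ s x - c) : ℝ) : EReal)

/-- `(1/√n) E primalObj` for i.i.d. standard normal `A` and `v`. -/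
def primalMean (m n : ℕ) (σ : ℝ) (s : EuclideanSpace ℝ (Fin n)) (c : ℝ) : EReal :=
  (((√(n : ℝ))⁻¹ : ℝ) : EReal) *
    expect ((gaussMat m n).prod (gaussVec m)) fun ω => primalObj σ s c ω.1 ω.2

/-- `ξ_p`, with `m n` rows and prescribed overlap `c n` in dimension `n`. The overlaps of two
points of `binarySet n` lie on a grid which changes with `n`, so that for a constant overlap the
objective is `+∞` for infinitely many `n` (unless `|c| = 1`); the limit is the lower limit. -/
def xiPrimal (σ : ℝ) (m : ℕ → ℕ) (s : ∀ n, EuclideanSpace ℝ (Fin n)) (c : ℕ → ℝ) : EReal :=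
  liminf (fun n => primalMean (m n) n σ (s n) (c n)) atTop

/-- The random dual objective
`min_{x ∈ X} max_{‖λ‖ = 1} λᵀg √(d x + σ²) - ‖λ‖ (hᵀ(s - x) + h₀ σ) + √n ν (sᵀx - c)`,
where `d x` stands for the squared distance of `x` and `s`. -/
def dualObj {m n : ℕ} (d : EuclideanSpace ℝ (Fin n) → ℝ) (σ : ℝ)
    (s : EuclideanSpace ℝ (Fin n)) (c ν : ℝ)
    (g : Fin m → ℝ) (h : Fin n → ℝ) (h₀ : ℝ) : EReal :=
  ⨅ x ∈ binarySet n, ⨆ l ∈ Metric.sphere (0 : EuclideanSpace ℝ (Fin m)) 1,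
    (((l.ofLp ⬝ᵥ g) * √(d x + σ ^ 2) - ‖l‖ * (h ⬝ᵥ (s - x).ofLp + h₀ * σ)
      + √(n : ℝ) * ν * (inner ℝ s x - c) : ℝ) : EReal)

/-- `(1/√n) E dualObj` for independent standard normal `g`, `h`, `h₀`. -/
def dualMean (m n : ℕ) (d : EuclideanSpace ℝ (Fin n) → ℝ) (σ : ℝ)
    (s : EuclideanSpace ℝ (Fin n)) (c ν : ℝ) : EReal :=
  (((√(n : ℝ))⁻¹ : ℝ) : EReal) *
    expect ((gaussVec m).prod ((gaussVec n).prod (gaussianReal 0 1)))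
      fun ω => dualObj d σ s c ν ω.1 ω.2.1 ω.2.2

/-- Random dual that keeps `‖s - x‖²` inside the minimum. -/
def dualMeanFree (m n : ℕ) (σ : ℝ) (s : EuclideanSpace ℝ (Fin n)) (c ν : ℝ) : EReal :=
  dualMean m n (fun x => ‖s - x‖ ^ 2) σ s c ν

/-- Random dual in which `‖s - x‖²` is replaced by `2 - 2 c`, the value which the constraint
`sᵀx = c` gives to it. -/
def dualMeanFixed (m n : ℕ) (σ : ℝ) (s : EuclideanSpace ℝ (Fin n)) (c ν : ℝ) : EReal :=
  dualMean m n (fun _ => 2 - 2 * c) σ s c ν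

/-- `ξ_RD = √α √(2 - 2 c + σ²) - E|h + ν| - ν c`, with `h` standard normal. -/
def xiRD (α σ c ν : ℝ) : ℝ :=
  √α * √(2 - 2 * c + σ ^ 2) - (∫ t, |t + ν| ∂(gaussianReal 0 1)) - ν * c

/-- The error function. -/
def erf (x : ℝ) : ℝ := 2 / √Real.pi * ∫ t in (0 : ℝ)..x, Real.exp (-t ^ 2)

/-- The inverse error function, with `erfinv (-1) = -∞` and `erfinv 1 = +∞`. -/
def erfinv (y : ℝ) : EReal := sSup ((fun t : ℝ => (t : EReal)) '' {t | erf t ≤ y})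

/-- `√α √(2 - 2 c + σ²) - √(2/π) exp(-(√2 erfinv(-c))² / 2)`, with `exp(-∞) = 0`. -/
def mlBound (α σ c : ℝ) : ℝ :=
  √α * √(2 - 2 * c + σ ^ 2) -
    √(2 / Real.pi) *
      (EReal.exp (-((((√2 : ℝ) : EReal) * erfinv (-c)) ^ 2 / 2))).toReal

end MLDetection

end

noncomputable section

namespace MLDetection

/-- The standard Gaussian measure on `ι → ℝ`. -/
def gaussPi (ι : Type*) [Fintype ι] : Measure (ι → ℝ) :=
  Measure.pi fun _ => gaussianReal 0 1

instance (ι : Type*) [Fintype ι] : IsProbabilityMeasure (gaussPi ι) := by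
  unfold gaussPi; infer_instance

theorem gaussianPDFReal_std (t : ℝ) :
    gaussianPDFReal 0 1 t = (√(2 * Real.pi))⁻¹ * Real.exp (-t ^ 2 / 2) := by
  simp [gaussianPDFReal_def]

theorem hasDerivAt_gaussianPDFReal_std (t : ℝ) :
    HasDerivAt (gaussianPDFReal 0 1) (-(t * gaussianPDFReal 0 1 t)) t := by
  have h : HasDerivAt (fun t : ℝ => (√(2 * Real.pi))⁻¹ * Real.exp (-t ^ 2 / 2))
      ((√(2 * Real.pi))⁻¹ * (Real.exp (-t ^ 2 / 2) * (-(2 * t) / 2))) t := by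
    refine HasDerivAt.const_mul _ (HasDerivAt.exp ?_)
    simpa using ((hasDerivAt_pow 2 t).neg.div_const 2)
  have h2 : gaussianPDFReal 0 1 = fun t : ℝ => (√(2 * Real.pi))⁻¹ * Real.exp (-t ^ 2 / 2) :=
    funext gaussianPDFReal_std
  rw [h2]
  convert h using 1
  ring

theorem integrable_mul_gaussianPDFReal_std :
    Integrable (fun t : ℝ => t * gaussianPDFReal 0 1 t) := by
  have h := (integrable_mul_exp_neg_mul_sq (b := 1 / 2) (by norm_num)).const_mul
    (√(2 * Real.pi))⁻¹
  refine h.congr (Eventually.of_forall fun t => ?_)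
  simp only [gaussianPDFReal_std]
  rw [show -(1 / 2 : ℝ) * t ^ 2 = -t ^ 2 / 2 by ring]
  ring

/-- **Stein's identity** in dimension one. -/
theorem integral_mul_gaussianReal_eq {g g' : ℝ → ℝ} {C : ℝ} (hg : ∀ t, HasDerivAt g (g' t) t)
    (hb : ∀ t, |g t| ≤ C) (hb' : ∀ t, |g' t| ≤ C) :
    ∫ t, t * g t ∂(gaussianReal 0 1) = ∫ t, g' t ∂(gaussianReal 0 1) := by
  have hgc : Continuous g := continuous_iff_continuousAt.2 fun t => (hg t).continuousAt
  have hg'm : Measurable g' := by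
    have : g' = deriv g := funext fun t => (hg t).deriv.symm
    rw [this]; exact measurable_deriv g
  rw [integral_gaussianReal_eq_integral_smul one_ne_zero,
    integral_gaussianReal_eq_integral_smul one_ne_zero]
  have key := integral_mul_deriv_eq_deriv_mul_of_integrable (u := g) (u' := g')
    (v := gaussianPDFReal 0 1) (v' := fun t => -(t * gaussianPDFReal 0 1 t))
    (fun x _ => hg x) (fun x _ => hasDerivAt_gaussianPDFReal_std x)
    (integrable_mul_gaussianPDFReal_std.neg.bdd_mul (c := C) hgc.aestronglyMeasurable
      (Eventually.of_forall hb))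
    ((integrable_gaussianPDFReal 0 1).bdd_mul (c := C) hg'm.aestronglyMeasurable
      (Eventually.of_forall hb'))
    ((integrable_gaussianPDFReal 0 1).bdd_mul (c := C) hgc.aestronglyMeasurable
      (Eventually.of_forall hb))
  have h1 : ∀ t, gaussianPDFReal 0 1 t • (t * g t) = -(g t * -(t * gaussianPDFReal 0 1 t)) := by
    intro t; simp only [smul_eq_mul]; ring
  simp_rw [h1, integral_neg]
  rw [key, neg_neg]
  congr 1; ext t; simp only [smul_eq_mul]; ring

section GaussianVector

variable {ι : Type*} [Fintype ι]

theorem measurePreserving_eval_gaussPi (i : ι) :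
    MeasurePreserving (fun ω : ι → ℝ => ω i) (gaussPi ι) (gaussianReal 0 1) :=
  measurePreserving_eval (fun _ : ι => gaussianReal 0 1) i

theorem memLp_eval_gaussPi (i : ι) (p : NNReal) :
    MemLp (fun ω : ι → ℝ => ω i) p (gaussPi ι) :=
  (memLp_id_gaussianReal (μ := 0) (v := 1) p).comp_measurePreserving
    (measurePreserving_eval_gaussPi i)

theorem integrable_eval_gaussPi (i : ι) : Integrable (fun ω : ι → ℝ => ω i) (gaussPi ι) := by
  simpa using (memLp_eval_gaussPi i 1).integrable (by simp)

/-- Resampling one coordinate preserves the standard Gaussian measure. -/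
theorem measurePreserving_update_gaussPi [DecidableEq ι] (i : ι) :
    MeasurePreserving (fun p : (ι → ℝ) × ℝ => Function.update p.1 i p.2)
      ((gaussPi ι).prod (gaussianReal 0 1)) (gaussPi ι) := by
  have hm : Measurable fun p : (ι → ℝ) × ℝ => Function.update p.1 i p.2 := by
    refine measurable_pi_iff.2 fun j => ?_
    by_cases h : j = i
    · subst h; simpa using measurable_snd
    · simp only [Function.update_of_ne h]
      exact (measurable_pi_apply j).comp measurable_fst
  refine ⟨hm, ?_⟩
  symm
  refine Measure.pi_eq fun s hs => ?_
  rw [Measure.map_apply hm (MeasurableSet.univ_pi hs)]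
  have hpre : (fun p : (ι → ℝ) × ℝ => Function.update p.1 i p.2) ⁻¹' Set.univ.pi s
      = (Set.univ.pi (Function.update s i Set.univ)) ×ˢ s i := by
    ext ⟨ω, t⟩
    simp only [Set.mem_preimage, Set.mem_pi, Set.mem_univ, true_imp_iff, Set.mem_prod]
    constructor
    · intro h
      refine ⟨fun j => ?_, by simpa using h i⟩
      by_cases hj : j = i
      · subst hj; simp
      · simpa [Function.update_of_ne hj] using h j
    · rintro ⟨h1, h2⟩ j
      by_cases hj : j = i
      · subst hj; simpa using h2
      · simpa [Function.update_of_ne hj] using h1 j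
  rw [hpre, Measure.prod_prod, gaussPi, Measure.pi_pi,
    ← Finset.mul_prod_erase _ _ (Finset.mem_univ i),
    ← Finset.mul_prod_erase _ (fun j => gaussianReal 0 1 (s j)) (Finset.mem_univ i), mul_comm]
  simp only [Function.update_self, measure_univ, one_mul]
  congr 1
  refine Finset.prod_congr rfl fun j hj => ?_
  rw [Function.update_of_ne (Finset.ne_of_mem_erase hj)]

/-- **Stein's identity** for one coordinate of a standard Gaussian vector. -/
theorem integral_coord_mul_gaussPi_eq [DecidableEq ι] (i : ι) {G G' : (ι → ℝ) → ℝ} {C : ℝ}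
    (hG : ∀ ω t, HasDerivAt (fun t => G (Function.update ω i t)) (G' (Function.update ω i t)) t)
    (hGm : Measurable G) (hGm' : Measurable G')
    (hb : ∀ ω, |G ω| ≤ C) (hb' : ∀ ω, |G' ω| ≤ C) :
    ∫ ω, ω i * G ω ∂(gaussPi ι) = ∫ ω, G' ω ∂(gaussPi ι) := by
  have hmp := measurePreserving_update_gaussPi (ι := ι) i
  have hI1 : Integrable (fun ω : ι → ℝ => ω i * G ω) (gaussPi ι) :=
    (integrable_eval_gaussPi i).mul_bdd (c := C) hGm.aestronglyMeasurable (Eventually.of_forall hb)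
  have hI2 : Integrable G' (gaussPi ι) :=
    (integrable_const C).mono' hGm'.aestronglyMeasurable (Eventually.of_forall hb')
  have e : ∀ f : (ι → ℝ) → ℝ, Integrable f (gaussPi ι) → ∫ ω, f ω ∂(gaussPi ι) =
      ∫ ω, ∫ t, f (Function.update ω i t) ∂(gaussianReal 0 1) ∂(gaussPi ι) := by
    intro f hf
    have h := hmp.integrable_comp_of_integrable hf
    rw [← integral_prod (fun p : (ι → ℝ) × ℝ => f (Function.update p.1 i p.2)) h, ← hmp.map_eq,
      integral_map hmp.measurable.aemeasurable (by rw [hmp.map_eq]; exact hf.aestronglyMeasurable),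
      hmp.map_eq]
  rw [e _ hI1, e _ hI2]
  congr 1; ext ω
  simpa using integral_mul_gaussianReal_eq (hG ω) (fun t => hb _) (fun t => hb' _)

/-- Reindexing along an injection preserves standard Gaussian measures. -/
theorem measurePreserving_comp_gaussPi {κ : Type*} [Fintype κ] {e : κ → ι}
    (he : Function.Injective e) :
    MeasurePreserving (fun ω : ι → ℝ => fun k => ω (e k)) (gaussPi ι) (gaussPi κ) := by
  have hm : Measurable (fun ω : ι → ℝ => fun k => ω (e k)) :=
    measurable_pi_iff.2 fun k => measurable_pi_apply _
  refine ⟨hm, ?_⟩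
  have hind : iIndepFun (fun (i : ι) (ω : ι → ℝ) => ω i) (gaussPi ι) :=
    iIndepFun_pi (μ := fun _ : ι => gaussianReal 0 1) (X := fun _ => id) fun _ => aemeasurable_id
  have h2 := hind.precomp he
  have h3 := (iIndepFun_iff_map_fun_eq_pi_map
    (fun k => (measurable_pi_apply (e k)).aemeasurable)).1 h2
  refine h3.trans ?_
  simp_rw [(measurePreserving_eval_gaussPi _).map_eq]
  rfl

section Interpolation

variable {κ : Type*} [Fintype κ]

/-- **Gaussian interpolation**: if the covariances of the (independent) Gaussian vectors `P ω` and
`Q ω` satisfy `⟨P Pᵀ - Q Qᵀ, ∇²F⟩ ≥ 0` everywhere, then `E F(Q ω) ≤ E F(P ω)`. -/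
theorem integral_gaussPi_le_of_hessian_nonneg
    (F : (κ → ℝ) → ℝ) (F1 : κ → (κ → ℝ) → ℝ) (F2 : κ → κ → (κ → ℝ) → ℝ)
    (hF : ∀ w, HasFDerivAt F (∑ k, F1 k w • ContinuousLinearMap.proj (R := ℝ)
      (φ := fun _ : κ => ℝ) k) w)
    (hF1 : ∀ k w, HasFDerivAt (F1 k) (∑ l, F2 k l w • ContinuousLinearMap.proj (R := ℝ)
      (φ := fun _ : κ => ℝ) l) w)
    (hF2 : ∀ k l, Measurable (F2 k l)) {C : ℝ} (hC1 : ∀ k w, |F1 k w| ≤ C)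
    (hC2 : ∀ k l w, |F2 k l w| ≤ C) (P Q : κ → ι → ℝ) (hPQ : ∀ k l, ∑ i, P k i * Q l i = 0)
    (hpos : ∀ w, 0 ≤ ∑ k, ∑ l, (∑ i, P k i * P l i - ∑ i, Q k i * Q l i) * F2 k l w)
    (hint : ∀ R : κ → ι → ℝ, Integrable (fun ω => F fun k => ∑ i, R k i * ω i) (gaussPi ι)) :
    ∫ ω, F (fun k => ∑ i, Q k i * ω i) ∂(gaussPi ι)
      ≤ ∫ ω, F (fun k => ∑ i, P k i * ω i) ∂(gaussPi ι) := by
  classical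
  set R : ℝ → κ → ι → ℝ := fun θ k i => Real.sin θ * P k i + Real.cos θ * Q k i with hR
  set R' : ℝ → κ → ι → ℝ := fun θ k i => Real.cos θ * P k i - Real.sin θ * Q k i with hR'
  set W : ℝ → (ι → ℝ) → κ → ℝ := fun θ ω k => ∑ i, R θ k i * ω i with hW
  have hFc : Continuous F := continuous_iff_continuousAt.2 fun w => (hF w).continuousAt
  have hF1c : ∀ k, Continuous (F1 k) := fun k =>
    continuous_iff_continuousAt.2 fun w => (hF1 k w).continuousAt
  have hWc : ∀ θ, Continuous (W θ) := fun θ => by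
    refine continuous_pi fun k => continuous_finsetSum _ fun i _ => ?_
    exact continuous_const.mul (continuous_apply i)
  have hC : ∀ k : κ, 0 ≤ C := fun k => (abs_nonneg _).trans (hC1 k 0)
  -- derivative in the angle
  have hWd : ∀ ω θ, HasDerivAt (fun θ => W θ ω) (fun k => ∑ i, R' θ k i * ω i) θ := by
    intro ω θ
    refine hasDerivAt_pi.2 fun k => HasDerivAt.fun_sum fun i _ => HasDerivAt.mul_const ?_ _
    have := ((Real.hasDerivAt_sin θ).mul_const (P k i)).add
      ((Real.hasDerivAt_cos θ).mul_const (Q k i))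
    refine this.congr_deriv ?_
    simp only [hR']; ring
  have hFd : ∀ ω θ, HasDerivAt (fun θ => F (W θ ω))
      (∑ k, F1 k (W θ ω) * ∑ i, R' θ k i * ω i) θ := by
    intro ω θ
    have := (hF (W θ ω)).comp_hasDerivAt θ (hWd ω θ)
    simpa [Function.comp_def] using this
  have hφ : ∀ θ, HasDerivAt (fun θ => ∫ ω, F (W θ ω) ∂(gaussPi ι))
      (∫ ω, ∑ k, F1 k (W θ ω) * ∑ i, R' θ k i * ω i ∂(gaussPi ι)) θ := by
    intro θ
    refine (hasDerivAt_integral_of_dominated_loc_of_deriv_le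
      (F := fun θ ω => F (W θ ω))
      (F' := fun θ ω => ∑ k, F1 k (W θ ω) * ∑ i, R' θ k i * ω i)
      (bound := fun ω => ∑ k, C * ∑ i, (|P k i| + |Q k i|) * |ω i|) (s := Set.univ) univ_mem
      (Eventually.of_forall fun θ => (hint (R θ)).aestronglyMeasurable) (hint (R θ)) ?_ ?_ ?_ ?_).2
    · refine Continuous.aestronglyMeasurable ?_
      refine continuous_finsetSum _ fun k _ => ((hF1c k).comp (hWc θ)).mul ?_
      exact continuous_finsetSum _ fun i _ => continuous_const.mul (continuous_apply i)
    · refine Eventually.of_forall fun ω θ _ => ?_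
      refine (Finset.abs_sum_le_sum_abs _ _).trans (Finset.sum_le_sum fun k _ => ?_)
      rw [abs_mul]
      refine mul_le_mul (hC1 _ _) ?_ (abs_nonneg _) (hC k)
      refine (Finset.abs_sum_le_sum_abs _ _).trans (Finset.sum_le_sum fun i _ => ?_)
      rw [abs_mul]
      refine mul_le_mul_of_nonneg_right ?_ (abs_nonneg _)
      refine (abs_sub _ _).trans (add_le_add ?_ ?_) <;> rw [abs_mul]
      · exact mul_le_of_le_one_left (abs_nonneg _) (Real.abs_cos_le_one _)
      · exact mul_le_of_le_one_left (abs_nonneg _) (Real.abs_sin_le_one _)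
    · refine integrable_finsetSum _ fun k _ => Integrable.const_mul ?_ _
      exact integrable_finsetSum _ fun i _ => (integrable_eval_gaussPi i).abs.const_mul _
    · exact Eventually.of_forall fun ω θ _ => hFd ω θ
  -- Gaussian integration by parts
  have hstein : ∀ θ k i, ∫ ω, ω i * F1 k (W θ ω) ∂(gaussPi ι)
      = ∫ ω, ∑ l, F2 k l (W θ ω) * R θ l i ∂(gaussPi ι) := by
    intro θ k i
    have hbd : ∀ ω, |∑ l, F2 k l (W θ ω) * R θ l i| ≤ C * ∑ l, |R θ l i| := by
      intro ω
      rw [Finset.mul_sum]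
      refine (Finset.abs_sum_le_sum_abs _ _).trans (Finset.sum_le_sum fun l _ => ?_)
      rw [abs_mul]
      exact mul_le_mul_of_nonneg_right (hC2 _ _ _) (abs_nonneg _)
    refine integral_coord_mul_gaussPi_eq i (C := max C (C * ∑ l, |R θ l i|)) ?_
      ((hF1c k).comp (hWc θ)).measurable ?_ (fun ω => (hC1 _ _).trans (le_max_left _ _))
      (fun ω => (hbd ω).trans (le_max_right _ _))
    · intro ω t
      have h1 : HasDerivAt (fun t => W θ (Function.update ω i t)) (fun l => R θ l i) t := by
        refine hasDerivAt_pi.2 fun l => ?_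
        have h2 : HasDerivAt (fun t => W θ (Function.update ω i t) l)
            (∑ j, R θ l j * (Pi.single i (1 : ℝ) : ι → ℝ) j) t :=
          HasDerivAt.fun_sum fun j _ =>
            (hasDerivAt_pi.1 (hasDerivAt_update ω i t) j).const_mul _
        simpa [Pi.single_apply] using h2
      have := (hF1 k (W θ (Function.update ω i t))).comp_hasDerivAt t h1
      simpa [Function.comp_def] using this
    · refine Finset.measurable_fun_sum _ fun l _ => Measurable.mul_const ?_ _
      exact (hF2 k l).comp (hWc θ).measurable
  have hval : ∀ θ, ∫ ω, ∑ k, F1 k (W θ ω) * ∑ i, R' θ k i * ω i ∂(gaussPi ι)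
      = ∫ ω, (Real.sin θ * Real.cos θ) *
        ∑ k, ∑ l, (∑ i, P k i * P l i - ∑ i, Q k i * Q l i) * F2 k l (W θ ω) ∂(gaussPi ι) := by
    intro θ
    have hI1 : ∀ k i, Integrable (fun ω : ι → ℝ => ω i * F1 k (W θ ω)) (gaussPi ι) :=
      fun k i => (integrable_eval_gaussPi i).mul_bdd (c := C)
        ((hF1c k).comp (hWc θ)).aestronglyMeasurable (Eventually.of_forall fun ω => hC1 _ _)
    have hI2 : ∀ k l, Integrable (fun ω : ι → ℝ => F2 k l (W θ ω)) (gaussPi ι) :=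
      fun k l => (integrable_const C).mono'
        ((hF2 k l).comp (hWc θ).measurable).aestronglyMeasurable
        (Eventually.of_forall fun ω => hC2 _ _ _)
    calc _ = ∫ ω, ∑ k, ∑ i, R' θ k i * (ω i * F1 k (W θ ω)) ∂(gaussPi ι) := by
          congr 1; ext ω
          refine Finset.sum_congr rfl fun k _ => ?_
          rw [Finset.mul_sum]
          exact Finset.sum_congr rfl fun i _ => by ring
      _ = ∑ k, ∑ i, R' θ k i * ∫ ω, ω i * F1 k (W θ ω) ∂(gaussPi ι) := by
          rw [integral_finsetSum _ fun k _ => integrable_finsetSum _ fun i _ =>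
            (hI1 k i).const_mul _]
          refine Finset.sum_congr rfl fun k _ => ?_
          rw [integral_finsetSum _ fun i _ => (hI1 k i).const_mul _]
          exact Finset.sum_congr rfl fun i _ => integral_const_mul _ _
      _ = ∑ k, ∑ i, ∑ l, (R' θ k i * R θ l i) * ∫ ω, F2 k l (W θ ω) ∂(gaussPi ι) := by
          refine Finset.sum_congr rfl fun k _ => Finset.sum_congr rfl fun i _ => ?_
          rw [hstein, integral_finsetSum _ fun l _ => (hI2 k l).mul_const _, Finset.mul_sum]
          refine Finset.sum_congr rfl fun l _ => ?_
          rw [integral_mul_const]; ring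
      _ = ∑ k, ∑ l, (Real.sin θ * Real.cos θ * (∑ i, P k i * P l i - ∑ i, Q k i * Q l i)) *
            ∫ ω, F2 k l (W θ ω) ∂(gaussPi ι) := by
          refine Finset.sum_congr rfl fun k _ => ?_
          rw [Finset.sum_comm]
          refine Finset.sum_congr rfl fun l _ => ?_
          rw [← Finset.sum_mul]
          congr 1
          have hQP : ∑ i, Q k i * P l i = 0 := by
            rw [← hPQ l k]; exact Finset.sum_congr rfl fun i _ => mul_comm _ _
          have : ∀ i, R' θ k i * R θ l i = Real.sin θ * Real.cos θ * (P k i * P l i)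
              - Real.sin θ * Real.cos θ * (Q k i * Q l i)
              + Real.cos θ ^ 2 * (P k i * Q l i) - Real.sin θ ^ 2 * (Q k i * P l i) := by
            intro i; simp only [hR, hR']; ring
          simp_rw [this, Finset.sum_sub_distrib, Finset.sum_add_distrib, Finset.sum_sub_distrib,
            ← Finset.mul_sum, hPQ, hQP]
          ring
      _ = _ := by
          rw [integral_const_mul, integral_finsetSum _ fun k _ => integrable_finsetSum _ fun l _ =>
            (hI2 k l).const_mul _, Finset.mul_sum]
          refine Finset.sum_congr rfl fun k _ => ?_
          rw [integral_finsetSum _ fun l _ => (hI2 k l).const_mul _, Finset.mul_sum]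
          refine Finset.sum_congr rfl fun l _ => ?_
          rw [integral_const_mul]; ring
  have hmono : MonotoneOn (fun θ => ∫ ω, F (W θ ω) ∂(gaussPi ι)) (Set.Icc 0 (Real.pi / 2)) := by
    refine monotoneOn_of_deriv_nonneg (convex_Icc _ _)
      (fun θ _ => (hφ θ).continuousAt.continuousWithinAt)
      (fun θ _ => (hφ θ).differentiableAt.differentiableWithinAt) fun θ hθ => ?_
    rw [interior_Icc] at hθ
    rw [(hφ θ).deriv, hval]
    refine integral_nonneg fun ω => mul_nonneg (mul_nonneg ?_ ?_) (hpos _)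
    · exact Real.sin_nonneg_of_nonneg_of_le_pi hθ.1.le (by linarith [hθ.2, Real.pi_pos])
    · exact Real.cos_nonneg_of_mem_Icc ⟨by linarith [hθ.1, Real.pi_pos], hθ.2.le⟩
  have h := hmono (Set.left_mem_Icc.2 (by positivity)) (Set.right_mem_Icc.2 (by positivity))
    (by positivity)
  simpa [hW, hR] using h

end Interpolation

end GaussianVector

section SoftMin

variable {T O : Type*} [Fintype T]

/-- The smooth minimum `-log ∑ₓ exp (-ψ(wₓ))` over the blocks `wₓ` of `w`. -/
def softMin (ψ : (O → ℝ) → ℝ) (w : T × O → ℝ) : ℝ :=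
  -Real.log (∑ x, Real.exp (-ψ fun o => w (x, o)))

/-- The Gibbs weights of `softMin`. -/
def softMinWeight (ψ : (O → ℝ) → ℝ) (x : T) (w : T × O → ℝ) : ℝ :=
  Real.exp (softMin ψ w - ψ fun o => w (x, o))

theorem softMinWeight_nonneg (ψ : (O → ℝ) → ℝ) (x : T) (w : T × O → ℝ) :
    0 ≤ softMinWeight ψ x w := (Real.exp_pos _).le

theorem sum_softMinWeight [Nonempty T] (ψ : (O → ℝ) → ℝ) (w : T × O → ℝ) :
    ∑ x, softMinWeight ψ x w = 1 := by
  have hS : 0 < ∑ x : T, Real.exp (-ψ fun o => w (x, o)) :=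
    Finset.sum_pos (fun _ _ => Real.exp_pos _) Finset.univ_nonempty
  simp_rw [softMinWeight, sub_eq_add_neg, Real.exp_add, ← Finset.mul_sum, softMin, Real.exp_neg,
    Real.exp_log (by simpa [Real.exp_neg] using hS)]
  exact inv_mul_cancel₀ (by simpa [Real.exp_neg] using hS.ne')

theorem softMinWeight_le_one [Nonempty T] (ψ : (O → ℝ) → ℝ) (x : T) (w : T × O → ℝ) :
    softMinWeight ψ x w ≤ 1 := by
  rw [← sum_softMinWeight ψ w]
  exact Finset.single_le_sum (fun y _ => softMinWeight_nonneg ψ y w) (Finset.mem_univ x)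

theorem softMin_le (ψ : (O → ℝ) → ℝ) (w : T × O → ℝ) (x : T) :
    softMin ψ w ≤ ψ fun o => w (x, o) := by
  have h : Real.exp (-ψ fun o => w (x, o)) ≤ ∑ x, Real.exp (-ψ fun o => w (x, o)) :=
    Finset.single_le_sum (f := fun x => Real.exp (-ψ fun o => w (x, o)))
      (fun _ _ => (Real.exp_pos _).le) (Finset.mem_univ x)
  have h2 := Real.log_le_log (Real.exp_pos _) h
  rw [Real.log_exp] at h2
  rw [softMin]; linarith

theorem le_softMin [Nonempty T] (ψ : (O → ℝ) → ℝ) (w : T × O → ℝ) {c : ℝ}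
    (hc : ∀ x, c ≤ ψ fun o => w (x, o)) : c - Real.log (Fintype.card T) ≤ softMin ψ w := by
  have h : ∑ x : T, Real.exp (-ψ fun o => w (x, o)) ≤ Fintype.card T * Real.exp (-c) := by
    refine (Finset.sum_le_sum fun x _ => Real.exp_le_exp.2 (neg_le_neg (hc x))).trans ?_
    simp
  have hS : 0 < ∑ x : T, Real.exp (-ψ fun o => w (x, o)) :=
    Finset.sum_pos (fun _ _ => Real.exp_pos _) Finset.univ_nonempty
  have h2 := Real.log_le_log hS h
  rw [Real.log_mul (by simp) (Real.exp_pos _).ne', Real.log_exp] at h2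
  rw [softMin]; linarith

variable [Fintype O] {ψ : (O → ℝ) → ℝ} {a : O → (O → ℝ) → ℝ} {b : O → O → (O → ℝ) → ℝ}

theorem hasFDerivAt_block {f : (O → ℝ) → ℝ} {f' : O → (O → ℝ) → ℝ}
    (hf : ∀ u, HasFDerivAt f (∑ o, f' o u • ContinuousLinearMap.proj (R := ℝ)
      (φ := fun _ : O => ℝ) o) u) (x : T) (w : T × O → ℝ) :
    HasFDerivAt (fun w : T × O → ℝ => f fun o => w (x, o))
      (∑ o, f' o (fun o => w (x, o)) • ContinuousLinearMap.proj (R := ℝ)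
        (φ := fun _ : T × O => ℝ) (x, o)) w := by
  have h := (hf fun o => w (x, o)).comp w
    (ContinuousLinearMap.hasFDerivAt (x := w) (ContinuousLinearMap.pi fun o =>
      ContinuousLinearMap.proj (R := ℝ) (φ := fun _ : T × O => ℝ) (x, o)))
  refine h.congr_fderiv ?_
  ext v
  simp

theorem hasFDerivAt_softMin [Nonempty T]
    (hψ : ∀ u, HasFDerivAt ψ (∑ o, a o u • ContinuousLinearMap.proj (R := ℝ)
      (φ := fun _ : O => ℝ) o) u)
    (w : T × O → ℝ) :
    HasFDerivAt (softMin ψ) (∑ k : T × O, (softMinWeight ψ k.1 w * a k.2 fun o => w (k.1, o)) •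
      ContinuousLinearMap.proj (R := ℝ) (φ := fun _ : T × O => ℝ) k) w := by
  have hS : 0 < ∑ x : T, Real.exp (-ψ fun o => w (x, o)) :=
    Finset.sum_pos (fun _ _ => Real.exp_pos _) Finset.univ_nonempty
  have h := ((HasFDerivAt.fun_sum (u := Finset.univ) fun (x : T) _ =>
    (hasFDerivAt_block hψ x w).neg.exp).log hS.ne').neg
  refine h.congr_fderiv ?_
  have hp : ∀ x : T, softMinWeight ψ x w = (∑ x : T, Real.exp (-ψ fun o => w (x, o)))⁻¹ *
      Real.exp (-ψ fun o => w (x, o)) := by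
    intro x
    rw [softMinWeight, sub_eq_add_neg, Real.exp_add, softMin, Real.exp_neg, Real.exp_log hS]
  ext v
  simp [hp, Fintype.sum_prod_type, Finset.mul_sum, mul_assoc]

theorem hasFDerivAt_softMin_deriv [Nonempty T] [DecidableEq T]
    (hψ : ∀ u, HasFDerivAt ψ (∑ o, a o u • ContinuousLinearMap.proj (R := ℝ)
      (φ := fun _ : O => ℝ) o) u)
    (ha : ∀ o u, HasFDerivAt (a o) (∑ o', b o o' u • ContinuousLinearMap.proj (R := ℝ)
      (φ := fun _ : O => ℝ) o') u)
    (k : T × O) (w : T × O → ℝ) :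
    HasFDerivAt (fun w => softMinWeight ψ k.1 w * a k.2 fun o => w (k.1, o))
      (∑ l : T × O, ((if k.1 = l.1 then softMinWeight ψ k.1 w *
          ((b k.2 l.2 fun o => w (k.1, o)) -
            (a k.2 fun o => w (k.1, o)) * a l.2 fun o => w (k.1, o)) else 0) +
          (softMinWeight ψ k.1 w * a k.2 fun o => w (k.1, o)) *
          (softMinWeight ψ l.1 w * a l.2 fun o => w (l.1, o))) •
      ContinuousLinearMap.proj (R := ℝ) (φ := fun _ : T × O => ℝ) l) w := by
  have hp : HasFDerivAt (softMinWeight ψ k.1) _ w :=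
    ((hasFDerivAt_softMin hψ w).sub (hasFDerivAt_block hψ k.1 w)).exp
  have h := hp.mul (hasFDerivAt_block (ha k.2) k.1 w)
  refine h.congr_fderiv ?_
  ext v
  have e : Real.exp ((softMin ψ - fun w => ψ fun o => w (k.1, o) :
      (T × O → ℝ) → ℝ) w) = softMinWeight ψ k.1 w := rfl
  simp only [e, _root_.add_apply, _root_.smul_apply, smul_eq_mul, _root_.sum_apply,
    ContinuousLinearMap.proj_apply, _root_.sub_apply, add_mul, ite_mul, zero_mul,
    Finset.sum_add_distrib]
  have h1 : ∑ l : T × O, (if k.1 = l.1 then softMinWeight ψ k.1 w *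
          ((b k.2 l.2 fun o => w (k.1, o)) -
            (a k.2 fun o => w (k.1, o)) * a l.2 fun o => w (k.1, o)) * v l else 0)
      = ∑ o', softMinWeight ψ k.1 w * ((b k.2 o' fun o => w (k.1, o)) -
            (a k.2 fun o => w (k.1, o)) * a o' fun o => w (k.1, o)) * v (k.1, o') := by
    rw [Fintype.sum_prod_type, Finset.sum_comm]
    simp
  rw [h1]
  simp only [mul_sub, sub_mul, Finset.sum_sub_distrib, Finset.mul_sum]
  simp only [← mul_assoc]
  ring_nf

end SoftMin

section SmoothNorm

variable {M : Type*} [Fintype M]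

/-- A smooth version of `(u, r) ↦ ‖u‖ + r`. -/
def smoothNorm (u : Option M → ℝ) : ℝ := √(1 + ∑ j, u (some j) ^ 2) + u none

def smoothNormDeriv (o : Option M) (u : Option M → ℝ) : ℝ :=
  o.elim 1 fun j => u (some j) / √(1 + ∑ j, u (some j) ^ 2)

open Classical in
def smoothNormDeriv₂ (o o' : Option M) (u : Option M → ℝ) : ℝ :=
  o.elim 0 fun i => o'.elim 0 fun j => (if i = j then 1 else 0) / √(1 + ∑ j, u (some j) ^ 2) -
    u (some i) * u (some j) / √(1 + ∑ j, u (some j) ^ 2) ^ 3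

theorem one_add_sum_sq_pos (u : Option M → ℝ) : 0 < 1 + ∑ j, u (some j) ^ 2 := by positivity

theorem hasFDerivAt_sqrt_one_add (u : Option M → ℝ) :
    HasFDerivAt (fun u : Option M → ℝ => √(1 + ∑ j, u (some j) ^ 2))
      (∑ j, (u (some j) / √(1 + ∑ j, u (some j) ^ 2)) • ContinuousLinearMap.proj (R := ℝ)
        (φ := fun _ : Option M => ℝ) (some j)) u := by
  have h := ((HasFDerivAt.fun_sum (u := Finset.univ) fun (j : M) _ =>
    (hasFDerivAt_apply (𝕜 := ℝ) (F' := fun _ : Option M => ℝ) (some j) u).pow 2).const_add 1).sqrt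
    (one_add_sum_sq_pos u).ne'
  refine h.congr_fderiv ?_
  ext v
  simp only [_root_.smul_apply, _root_.sum_apply, smul_eq_mul,
    ContinuousLinearMap.proj_apply, Finset.mul_sum]
  refine Finset.sum_congr rfl fun j _ => ?_
  simp
  ring

theorem hasFDerivAt_smoothNorm (u : Option M → ℝ) :
    HasFDerivAt smoothNorm (∑ o, smoothNormDeriv o u • ContinuousLinearMap.proj (R := ℝ)
      (φ := fun _ : Option M => ℝ) o) u := by
  have h := (hasFDerivAt_sqrt_one_add u).add
    (hasFDerivAt_apply (𝕜 := ℝ) (F' := fun _ : Option M => ℝ) none u)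
  refine h.congr_fderiv ?_
  ext v
  simp [smoothNormDeriv, add_comm]

theorem hasFDerivAt_smoothNormDeriv (o : Option M) (u : Option M → ℝ) :
    HasFDerivAt (smoothNormDeriv o) (∑ o', smoothNormDeriv₂ o o' u •
      ContinuousLinearMap.proj (R := ℝ) (φ := fun _ : Option M => ℝ) o') u := by
  classical
  cases o with
  | none =>
    refine (hasFDerivAt_const (1 : ℝ) u).congr_fderiv ?_
    ext v
    simp [smoothNormDeriv₂]
  | some i =>
    have hN := Real.sqrt_pos.2 (one_add_sum_sq_pos u)
    have h := (hasFDerivAt_apply (𝕜 := ℝ) (F' := fun _ : Option M => ℝ) (some i) u).mul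
      ((hasDerivAt_inv hN.ne').comp_hasFDerivAt u (hasFDerivAt_sqrt_one_add u))
    refine h.congr_fderiv ?_
    ext v
    simp only [smoothNormDeriv₂, _root_.smul_apply, _root_.sum_apply,
      _root_.add_apply, smul_eq_mul, ContinuousLinearMap.proj_apply, Function.comp_apply,
      Fintype.sum_option, Option.elim_none, Option.elim_some, zero_mul, zero_add, sub_mul,
      Finset.sum_sub_distrib, Finset.mul_sum]
    simp only [ite_div, zero_div, ite_mul, zero_mul, Finset.sum_ite_eq, Finset.mem_univ, if_true]
    rw [add_comm, sub_eq_add_neg, ← Finset.sum_neg_distrib]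
    congr 1
    · field_simp
    · refine Finset.sum_congr rfl fun j _ => ?_
      field_simp

theorem abs_div_sqrt_one_add_le (u : Option M → ℝ) (j : M) :
    |u (some j)| / √(1 + ∑ j, u (some j) ^ 2) ≤ 1 := by
  rw [div_le_one (Real.sqrt_pos.2 (one_add_sum_sq_pos u))]
  refine Real.abs_le_sqrt ?_
  have := Finset.single_le_sum (f := fun j => u (some j) ^ 2) (fun j _ => sq_nonneg _)
    (Finset.mem_univ j)
  exact this.trans (by linarith)

theorem abs_smoothNormDeriv_le (o : Option M) (u : Option M → ℝ) : |smoothNormDeriv o u| ≤ 1 := by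
  cases o with
  | none => simp [smoothNormDeriv]
  | some j =>
    simp only [smoothNormDeriv, Option.elim_some, abs_div, abs_of_nonneg (Real.sqrt_nonneg _)]
    exact abs_div_sqrt_one_add_le u j

theorem abs_smoothNormDeriv₂_le (o o' : Option M) (u : Option M → ℝ) :
    |smoothNormDeriv₂ o o' u| ≤ 2 := by
  classical
  cases o with
  | none => simp [smoothNormDeriv₂]
  | some i =>
    cases o' with
    | none => simp [smoothNormDeriv₂]
    | some j =>
      set N := √(1 + ∑ j, u (some j) ^ 2) with hN
      have hN1 : 1 ≤ N := Real.one_le_sqrt.2 (by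
        have : 0 ≤ ∑ j, u (some j) ^ 2 := by positivity
        linarith)
      have hN0 : 0 < N := by linarith
      have h1 : |(if i = j then (1 : ℝ) else 0) / N| ≤ 1 := by
        rw [abs_div, abs_of_pos hN0, div_le_one hN0]
        refine le_trans ?_ hN1
        split_ifs <;> simp
      have h2 : |u (some i) * u (some j) / N ^ 3| ≤ 1 := by
        have e : |u (some i) * u (some j) / N ^ 3|
            = (|u (some i)| / N) * (|u (some j)| / N) * (1 / N) := by
          rw [abs_div, abs_mul, abs_of_pos (pow_pos hN0 3)]
          field_simp
        rw [e]
        refine mul_le_one₀ (mul_le_one₀ (abs_div_sqrt_one_add_le u i) (by positivity)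
          (abs_div_sqrt_one_add_le u j)) (by positivity) ?_
        rw [div_le_one hN0]; exact hN1
      have h3 : smoothNormDeriv₂ (some i) (some j) u
        = (if i = j then (1 : ℝ) else 0) / N - u (some i) * u (some j) / N ^ 3 := by
        simp [smoothNormDeriv₂, hN]
      rw [h3]
      exact (abs_sub _ _).trans (by linarith)

theorem measurable_smoothNormDeriv₂ (o o' : Option M) : Measurable (smoothNormDeriv₂ o o') := by
  unfold smoothNormDeriv₂
  cases o <;> cases o' <;> simp only [Option.elim_none, Option.elim_some] <;> fun_prop

theorem sum_smoothNormDeriv_mul_le (u v : Option M → ℝ) :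
    ∑ j, smoothNormDeriv (some j) u * smoothNormDeriv (some j) v ≤ 1 := by
  have h : ∀ u : Option M → ℝ, ∑ j, smoothNormDeriv (some j) u ^ 2 ≤ 1 := by
    intro u
    simp only [smoothNormDeriv, Option.elim_some, div_pow, ← Finset.sum_div,
      Real.sq_sqrt (one_add_sum_sq_pos u).le]
    rw [div_le_one (one_add_sum_sq_pos u)]
    linarith
  have h2 : ∑ j, 2 * (smoothNormDeriv (some j) u * smoothNormDeriv (some j) v)
      ≤ ∑ j, (smoothNormDeriv (some j) u ^ 2 + smoothNormDeriv (some j) v ^ 2) :=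
    Finset.sum_le_sum fun j _ => by
      nlinarith [sq_nonneg (smoothNormDeriv (some j) u - smoothNormDeriv (some j) v)]
  rw [← Finset.mul_sum, Finset.sum_add_distrib] at h2
  linarith [h u, h v]

theorem smoothNorm_bounds (u : Option M → ℝ) :
    √(∑ j, u (some j) ^ 2) + u none ≤ smoothNorm u ∧
      smoothNorm u ≤ 1 + √(∑ j, u (some j) ^ 2) + u none := by
  have h0 : 0 ≤ ∑ j, u (some j) ^ 2 := by positivity
  constructor
  · exact add_le_add_left (Real.sqrt_le_sqrt (by linarith)) _
  · refine add_le_add_left ?_ _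
    rw [Real.sqrt_le_iff]
    have := Real.sqrt_nonneg (∑ j, u (some j) ^ 2)
    exact ⟨by positivity, by nlinarith [Real.sq_sqrt h0]⟩

end SmoothNorm

section Gordon

theorem integrable_softMin_smoothNorm {T M ι : Type*} [Fintype T] [Fintype M] [Fintype ι]
    [Nonempty T]
    (R : T × Option M → ι → ℝ) :
    Integrable (fun ω => softMin smoothNorm fun k : T × Option M => ∑ i, R k i * ω i)
      (gaussPi ι) := by
  have hlin : ∀ k, Integrable (fun ω : ι → ℝ => ∑ i, R k i * ω i) (gaussPi ι) := fun k =>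
    integrable_finsetSum _ fun i _ => (integrable_eval_gaussPi i).const_mul _
  have hc : Continuous fun ω : ι → ℝ => fun k : T × Option M => ∑ i, R k i * ω i :=
    continuous_pi fun k => continuous_finsetSum _ fun i _ => continuous_const.mul
      (continuous_apply i)
  have hF : Continuous (softMin (T := T) (smoothNorm (M := M))) :=
    continuous_iff_continuousAt.2 fun w =>
      (hasFDerivAt_softMin hasFDerivAt_smoothNorm w).continuousAt
  refine Integrable.mono' (g := fun ω => (1 + Real.log (Fintype.card T)) + ∑ k : T × Option M,
    |∑ i, R k i * ω i|) ((integrable_const _).add (integrable_finsetSum _ fun k _ => (hlin k).abs))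
    (hF.comp hc).aestronglyMeasurable (Eventually.of_forall fun ω => ?_)
  set w : T × Option M → ℝ := fun k => ∑ i, R k i * ω i
  have hT : 0 ≤ Real.log (Fintype.card T) := Real.log_natCast_nonneg _
  have hsq : ∀ x, √(∑ j, w (x, some j) ^ 2) ≤ ∑ j, |w (x, some j)| := by
    intro x
    refine Real.sqrt_le_iff.2 ⟨by positivity, ?_⟩
    simp_rw [← sq_abs (w _)]
    exact Finset.sum_sq_le_sq_sum_of_nonneg fun _ _ => abs_nonneg _
  have hx : ∀ x, ∑ o, |w (x, o)| ≤ ∑ k, |w k| := fun x => by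
    rw [Fintype.sum_prod_type]
    exact Finset.single_le_sum (f := fun x => ∑ o, |w (x, o)|)
      (fun _ _ => Finset.sum_nonneg fun _ _ => abs_nonneg _) (Finset.mem_univ x)
  rw [Real.norm_eq_abs, abs_le]
  constructor
  · have := le_softMin smoothNorm w (c := -∑ k, |w k|) fun x => by
      have h1 := (smoothNorm_bounds fun o => w (x, o)).1
      have h2 := hx x
      rw [Fintype.sum_option] at h2
      have h3 := neg_abs_le (w (x, none))
      have h4 : 0 ≤ ∑ j, |w (x, some j)| := Finset.sum_nonneg fun _ _ => abs_nonneg _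
      have h5 := Real.sqrt_nonneg (∑ j, w (x, some j) ^ 2)
      linarith
    linarith
  · obtain ⟨x⟩ := ‹Nonempty T›
    have h0 := softMin_le smoothNorm w x
    have h1 := (smoothNorm_bounds fun o => w (x, o)).2
    have h2 := hx x
    rw [Fintype.sum_option] at h2
    have h3 := le_abs_self (w (x, none))
    have h4 := hsq x
    linarith

variable {T K M : Type*} [Fintype K] [Fintype M]

/-- Coefficients of the process `(A zₓ, 0)`. -/
def gordonP [DecidableEq M] (z : T → K → ℝ) (k : T × Option M) (i : (K × M) ⊕ (M ⊕ K)) : ℝ :=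
  k.2.elim 0 fun j => i.elim (fun p => if p.2 = j then z k.1 p.1 else 0) fun _ => 0

/-- Coefficients of the process `(τ g, ⟨h, zₓ⟩)`. -/
def gordonQ [DecidableEq M] (z : T → K → ℝ) (τ : ℝ) (k : T × Option M)
    (i : (K × M) ⊕ (M ⊕ K)) : ℝ :=
  i.elim (fun _ => 0) fun i => i.elim (fun j' => k.2.elim 0 fun j => if j' = j then τ else 0)
    fun l => k.2.elim (z k.1 l) fun _ => 0

variable [DecidableEq M]

theorem gordonP_mul_gordonQ (z : T → K → ℝ) (τ : ℝ) (k l : T × Option M) :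
    ∑ i, gordonP z k i * gordonQ z τ l i = 0 := by
  refine Finset.sum_eq_zero fun i _ => ?_
  rcases i with p | i
  · simp [gordonQ]
  · cases h : k.2 <;> simp [gordonP, h]

theorem gordonP_gram_sub (z : T → K → ℝ) (τ : ℝ) (x y : T) (o o' : Option M) :
    ∑ i, gordonP z (x, o) i * gordonP z (y, o') i -
      ∑ i, gordonQ z τ (x, o) i * gordonQ z τ (y, o') i =
    if o = o' then o.elim (-∑ k, z x k * z y k) fun _ => ∑ k, z x k * z y k - τ ^ 2 else 0 := by
  cases o <;> cases o' <;>
    simp [gordonP, gordonQ, Fintype.sum_prod_type, sq]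
  rename_i i j
  by_cases h : i = j
  · subst h; simp
  · simp [h, Ne.symm h]

theorem sum_gordonP (z : T → K → ℝ) (x : T) (o : Option M) (ω : (K × M) ⊕ (M ⊕ K) → ℝ) :
    ∑ i, gordonP z (x, o) i * ω i = o.elim 0 fun j => ∑ k, z x k * ω (Sum.inl (k, j)) := by
  cases o <;> simp [gordonP, Fintype.sum_prod_type]

theorem sum_gordonQ (z : T → K → ℝ) (τ : ℝ) (x : T) (o : Option M)
    (ω : (K × M) ⊕ (M ⊕ K) → ℝ) :
    ∑ i, gordonQ z τ (x, o) i * ω i =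
      o.elim (∑ k, z x k * ω (Sum.inr (Sum.inr k))) fun j => τ * ω (Sum.inr (Sum.inl j)) := by
  cases o <;> simp [gordonQ]

variable [Fintype T]

theorem gordon_hessian_nonneg [Nonempty T] [DecidableEq T] (z : T → K → ℝ) (τ : ℝ)
    (hz : ∀ x, ∑ k, z x k ^ 2 = τ ^ 2) (w : T × Option M → ℝ) :
    0 ≤ ∑ k, ∑ l, (∑ i, gordonP z k i * gordonP z l i - ∑ i, gordonQ z τ k i * gordonQ z τ l i) *
      ((if k.1 = l.1 then softMinWeight smoothNorm k.1 w *
          ((smoothNormDeriv₂ k.2 l.2 fun o => w (k.1, o)) -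
            (smoothNormDeriv k.2 fun o => w (k.1, o)) * smoothNormDeriv l.2 fun o => w (k.1, o))
          else 0) +
        (softMinWeight smoothNorm k.1 w * smoothNormDeriv k.2 fun o => w (k.1, o)) *
        (softMinWeight smoothNorm l.1 w * smoothNormDeriv l.2 fun o => w (l.1, o))) := by
  set p : T → ℝ := fun x => softMinWeight smoothNorm x w
  set α : T → M → ℝ := fun x j => smoothNormDeriv (some j) fun o => w (x, o)
  set G : T → T → ℝ := fun x y => ∑ k, z x k * z y k
  have hG : ∀ x, G x x = τ ^ 2 := fun x => by rw [← hz x]; simp [G, sq]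
  have hGle : ∀ x y, G x y ≤ τ ^ 2 := fun x y => by
    have h2 : ∑ k, 2 * (z x k * z y k) ≤ ∑ k, (z x k ^ 2 + z y k ^ 2) :=
      Finset.sum_le_sum fun j _ => by nlinarith [sq_nonneg (z x j - z y j)]
    rw [← Finset.mul_sum, Finset.sum_add_distrib, hz, hz] at h2
    linarith
  have hp1 : ∑ x, p x = 1 := sum_softMinWeight _ _
  have key : ∑ x, ∑ y, p x * p y * ((τ ^ 2 - G x y) * (1 - ∑ j, α x j * α y j)) = ∑ k, ∑ l,
      (∑ i, gordonP z k i * gordonP z l i - ∑ i, gordonQ z τ k i * gordonQ z τ l i) *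
      ((if k.1 = l.1 then softMinWeight smoothNorm k.1 w *
          ((smoothNormDeriv₂ k.2 l.2 fun o => w (k.1, o)) -
            (smoothNormDeriv k.2 fun o => w (k.1, o)) * smoothNormDeriv l.2 fun o => w (k.1, o))
          else 0) +
        (softMinWeight smoothNorm k.1 w * smoothNormDeriv k.2 fun o => w (k.1, o)) *
        (softMinWeight smoothNorm l.1 w * smoothNormDeriv l.2 fun o => w (l.1, o))) := by
    have h1 : ∀ x, ∑ o : Option M, ∑ y, ∑ o' : Option M,
        (∑ i, gordonP z (x, o) i * gordonP z (y, o') i -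
          ∑ i, gordonQ z τ (x, o) i * gordonQ z τ (y, o') i) *
        ((if x = y then p x * ((smoothNormDeriv₂ o o' fun o => w (x, o)) -
            (smoothNormDeriv o fun o => w (x, o)) * smoothNormDeriv o' fun o => w (x, o))
          else 0) + (p x * smoothNormDeriv o fun o => w (x, o)) *
        (p y * smoothNormDeriv o' fun o => w (y, o))) =
        p x * τ ^ 2 + ∑ y, p x * p y * (-G x y + (G x y - τ ^ 2) * ∑ j, α x j * α y j) := by
      intro x
      simp only [gordonP_gram_sub]
      rw [Finset.sum_comm]
      have h2 : ∀ y, ∑ o : Option M, ∑ o' : Option M,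
          (if o = o' then o.elim (-∑ k, z x k * z y k) fun _ => ∑ k, z x k * z y k - τ ^ 2
            else 0) *
          ((if x = y then p x * ((smoothNormDeriv₂ o o' fun o => w (x, o)) -
              (smoothNormDeriv o fun o => w (x, o)) * smoothNormDeriv o' fun o => w (x, o))
            else 0) + (p x * smoothNormDeriv o fun o => w (x, o)) *
          (p y * smoothNormDeriv o' fun o => w (y, o))) =
          (if x = y then p x * τ ^ 2 else 0) +
            p x * p y * (-G x y + (G x y - τ ^ 2) * ∑ j, α x j * α y j) := by
        intro y
        simp only [ite_mul, zero_mul, Finset.sum_ite_eq, Finset.mem_univ, if_true,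
          Fintype.sum_option, Option.elim_none, Option.elim_some]
        by_cases hxy : x = y
        · subst hxy
          have e1 : ∑ k, z x k * z x k = τ ^ 2 := hG x
          simp [e1, hG, smoothNormDeriv, smoothNormDeriv₂]
          ring
        · simp only [if_neg hxy, zero_add]
          have e1 : ∑ k, z x k * z y k = G x y := rfl
          simp only [e1, smoothNormDeriv, Option.elim_none, mul_one]
          rw [mul_add, mul_comm (p x * p y) (-G x y), ← mul_assoc, Finset.mul_sum,
            Finset.mul_sum]
          congr 1
          refine Finset.sum_congr rfl fun j _ => ?_
          simp only [α, smoothNormDeriv, Option.elim_some]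
          ring
      simp only [h2, Finset.sum_add_distrib, Finset.sum_ite_eq, Finset.mem_univ, if_true]
    simp only [Fintype.sum_prod_type]
    rw [Finset.sum_congr rfl fun x _ => h1 x, Finset.sum_add_distrib, ← Finset.sum_mul, hp1,
      one_mul]
    have h3 : τ ^ 2 = ∑ x, ∑ y, p x * p y * τ ^ 2 := by
      simp_rw [mul_assoc, ← Finset.mul_sum, ← Finset.sum_mul, hp1, one_mul]
    rw [h3]
    simp_rw [← Finset.sum_add_distrib]
    rw [← h3]
    exact Finset.sum_congr rfl fun x _ => Finset.sum_congr rfl fun y _ => by ring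
  rw [← key]
  refine Finset.sum_nonneg fun x _ => Finset.sum_nonneg fun y _ =>
    mul_nonneg (mul_nonneg (softMinWeight_nonneg _ _ _) (softMinWeight_nonneg _ _ _))
      (mul_nonneg (sub_nonneg.2 (hGle x y)) (sub_nonneg.2 (sum_smoothNormDeriv_mul_le _ _)))

theorem gordon_softMin [Nonempty T] (z : T → K → ℝ) (τ : ℝ)
    (hz : ∀ x, ∑ k, z x k ^ 2 = τ ^ 2) :
    ∫ ω, softMin smoothNorm (fun k : T × Option M => ∑ i, gordonQ z τ k i * ω i)
        ∂(gaussPi ((K × M) ⊕ (M ⊕ K))) ≤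
      ∫ ω, softMin smoothNorm (fun k : T × Option M => ∑ i, gordonP z k i * ω i)
        ∂(gaussPi ((K × M) ⊕ (M ⊕ K))) := by
  classical
  have hC1 : ∀ (k : T × Option M) w,
      |softMinWeight smoothNorm k.1 w * smoothNormDeriv k.2 fun o => w (k.1, o)| ≤ 1 := by
    intro k w
    rw [abs_mul, abs_of_nonneg (softMinWeight_nonneg _ _ _)]
    exact mul_le_one₀ (softMinWeight_le_one _ _ _) (abs_nonneg _) (abs_smoothNormDeriv_le _ _)
  refine integral_gaussPi_le_of_hessian_nonneg _ _ _
    (hasFDerivAt_softMin hasFDerivAt_smoothNorm)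
    (hasFDerivAt_softMin_deriv hasFDerivAt_smoothNorm hasFDerivAt_smoothNormDeriv) ?_
    (C := 4) (fun k w => (hC1 k w).trans (by norm_num)) ?_ _ _
    (gordonP_mul_gordonQ z τ) (gordon_hessian_nonneg z τ hz) integrable_softMin_smoothNorm
  · intro k l
    have hb : ∀ x : T, Measurable fun w : T × Option M → ℝ => fun o => w (x, o) := fun x =>
      measurable_pi_iff.2 fun o => measurable_pi_apply _
    have hs : ∀ x : T, Measurable (softMinWeight (T := T) (smoothNorm (M := M)) x) := fun x => by
      have h1 : Measurable (softMin (T := T) (smoothNorm (M := M))) :=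
        (continuous_iff_continuousAt.2 fun w =>
          (hasFDerivAt_softMin hasFDerivAt_smoothNorm w).continuousAt).measurable
      have h2 : Measurable (smoothNorm (M := M)) :=
        (continuous_iff_continuousAt.2 fun w => (hasFDerivAt_smoothNorm w).continuousAt).measurable
      exact (h1.sub (h2.comp (hb x))).exp
    have hd : ∀ (x : T) (o : Option M),
        Measurable fun w : T × Option M → ℝ => smoothNormDeriv o fun o => w (x, o) := fun x o =>
      (continuous_iff_continuousAt.2 fun w =>
        (hasFDerivAt_smoothNormDeriv o w).continuousAt).measurable.comp (hb x)
    refine Measurable.add ?_ (((hs _).mul (hd _ _)).mul ((hs _).mul (hd _ _)))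
    split_ifs
    · exact (hs _).mul (((measurable_smoothNormDeriv₂ _ _).comp (hb _)).sub
        ((hd _ _).mul (hd _ _)))
    · exact measurable_const
  · intro k l w
    have h1 : |(softMinWeight smoothNorm k.1 w * smoothNormDeriv k.2 fun o => w (k.1, o)) *
        (softMinWeight smoothNorm l.1 w * smoothNormDeriv l.2 fun o => w (l.1, o))| ≤ 1 := by
      rw [abs_mul]
      exact mul_le_one₀ (hC1 k w) (abs_nonneg _) (hC1 l w)
    have h2 : |if k.1 = l.1 then softMinWeight smoothNorm k.1 w *
          ((smoothNormDeriv₂ k.2 l.2 fun o => w (k.1, o)) -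
            (smoothNormDeriv k.2 fun o => w (k.1, o)) * smoothNormDeriv l.2 fun o => w (k.1, o))
          else 0| ≤ 3 := by
      split_ifs
      · rw [abs_mul, abs_of_nonneg (softMinWeight_nonneg _ _ _)]
        refine (mul_le_of_le_one_left (abs_nonneg _) (softMinWeight_le_one _ _ _)).trans ?_
        refine (abs_sub _ _).trans ?_
        rw [abs_mul]
        have := mul_le_one₀ (abs_smoothNormDeriv_le k.2 fun o => w (k.1, o)) (abs_nonneg _)
          (abs_smoothNormDeriv_le l.2 fun o => w (k.1, o))
        linarith [abs_smoothNormDeriv₂_le k.2 l.2 fun o => w (k.1, o)]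
      · simp
    exact (abs_add_le _ _).trans (by linarith)

/-- **Gordon's comparison inequality** for a finite family of vectors of equal length. -/
theorem gordon_min_le [Nonempty T] (z : T → K → ℝ) {τ : ℝ} (hτ : 0 ≤ τ)
    (hz : ∀ x, ∑ k, z x k ^ 2 = τ ^ 2) {f g : ((K × M) ⊕ (M ⊕ K) → ℝ) → ℝ}
    (hf : Integrable f (gaussPi ((K × M) ⊕ (M ⊕ K))))
    (hg : Integrable g (gaussPi ((K × M) ⊕ (M ⊕ K))))
    (hfle : ∀ ω x, f ω ≤ τ * √(∑ j, ω (Sum.inr (Sum.inl j)) ^ 2) +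
      ∑ k, z x k * ω (Sum.inr (Sum.inr k)))
    (hgle : ∀ ω, ∃ x, √(∑ j, (∑ k, z x k * ω (Sum.inl (k, j))) ^ 2) ≤ g ω) :
    ∫ ω, f ω ∂(gaussPi ((K × M) ⊕ (M ⊕ K))) ≤ ∫ ω, g ω ∂(gaussPi ((K × M) ⊕ (M ⊕ K))) := by
  have key : ∀ c : ℝ, 0 < c → c * ∫ ω, f ω ∂(gaussPi ((K × M) ⊕ (M ⊕ K))) ≤
      c * ∫ ω, g ω ∂(gaussPi ((K × M) ⊕ (M ⊕ K))) + (1 + Real.log (Fintype.card T)) := by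
    intro c hc
    set z' : T → K → ℝ := fun x k => c * z x k
    have hz' : ∀ x, ∑ k, z' x k ^ 2 = (c * τ) ^ 2 := fun x => by
      simp only [z', mul_pow, ← Finset.mul_sum, hz]
    have h := gordon_softMin (M := M) z' (c * τ) hz'
    have h1 : c * ∫ ω, f ω ∂(gaussPi ((K × M) ⊕ (M ⊕ K))) - Real.log (Fintype.card T) ≤
        ∫ ω, softMin smoothNorm (fun k : T × Option M => ∑ i, gordonQ z' (c * τ) k i * ω i)
        ∂(gaussPi ((K × M) ⊕ (M ⊕ K))) := by
      have e : c * ∫ ω, f ω ∂(gaussPi ((K × M) ⊕ (M ⊕ K))) - Real.log (Fintype.card T) =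
          ∫ ω, (c * f ω - Real.log (Fintype.card T)) ∂(gaussPi ((K × M) ⊕ (M ⊕ K))) := by
        rw [integral_sub (hf.const_mul c) (integrable_const _), integral_const_mul]
        simp
      rw [e]
      refine integral_mono ((hf.const_mul c).sub (integrable_const _))
        (integrable_softMin_smoothNorm _) fun ω => le_softMin _ _ fun x => ?_
      refine le_trans ?_ (smoothNorm_bounds _).1
      simp only [sum_gordonQ, Option.elim_some, Option.elim_none, mul_pow, ← Finset.mul_sum, z']
      rw [← mul_pow, Real.sqrt_mul (by positivity), Real.sqrt_sq (by positivity)]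
      have := mul_le_mul_of_nonneg_left (hfle ω x) hc.le
      simp only [mul_assoc, ← Finset.mul_sum]
      linarith
    have h2 : ∫ ω, softMin smoothNorm (fun k : T × Option M => ∑ i, gordonP z' k i * ω i)
        ∂(gaussPi ((K × M) ⊕ (M ⊕ K))) ≤ c * ∫ ω, g ω ∂(gaussPi ((K × M) ⊕ (M ⊕ K))) + 1 := by
      have e : c * ∫ ω, g ω ∂(gaussPi ((K × M) ⊕ (M ⊕ K))) + 1 =
          ∫ ω, (c * g ω + 1) ∂(gaussPi ((K × M) ⊕ (M ⊕ K))) := by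
        rw [integral_add (hg.const_mul c) (integrable_const _), integral_const_mul]
        simp
      rw [e]
      refine integral_mono (integrable_softMin_smoothNorm _)
        ((hg.const_mul c).add (integrable_const _)) fun ω => ?_
      obtain ⟨x, hx⟩ := hgle ω
      refine (softMin_le _ _ x).trans ((smoothNorm_bounds _).2.trans ?_)
      simp only [sum_gordonP, Option.elim_some, Option.elim_none, z', mul_assoc, ← Finset.mul_sum,
        mul_pow]
      rw [Real.sqrt_mul (by positivity), Real.sqrt_sq hc.le]
      have := mul_le_mul_of_nonneg_left hx hc.le
      linarith
    linarith
  by_contra! hlt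
  set D := ∫ ω, f ω ∂(gaussPi ((K × M) ⊕ (M ⊕ K))) - ∫ ω, g ω ∂(gaussPi ((K × M) ⊕ (M ⊕ K)))
    with hD
  have hD0 : 0 < D := sub_pos.2 hlt
  have hT : 0 ≤ Real.log (Fintype.card T) := Real.log_natCast_nonneg _
  have h := key ((2 + Real.log (Fintype.card T)) / D) (by positivity)
  have : (2 + Real.log (Fintype.card T)) / D * D = 2 + Real.log (Fintype.card T) :=
    div_mul_cancel₀ _ hD0.ne'
  rw [hD, mul_sub, ← hD] at this
  linarith

end Gordon

section ErrorFunction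

theorem hasDerivAt_erf (x : ℝ) : HasDerivAt erf (2 / √Real.pi * Real.exp (-x ^ 2)) x :=
  ((Continuous.integral_hasStrictDerivAt (f := fun t : ℝ => Real.exp (-t ^ 2)) (by fun_prop)
    0 x).hasDerivAt).const_mul _

theorem continuous_erf : Continuous erf :=
  continuous_iff_continuousAt.2 fun x => (hasDerivAt_erf x).continuousAt

theorem strictMono_erf : StrictMono erf :=
  strictMono_of_deriv_pos fun x => by
    rw [(hasDerivAt_erf x).deriv]
    have := Real.sqrt_pos.2 Real.pi_pos
    positivity

theorem erf_neg (x : ℝ) : erf (-x) = -erf x := by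
  have h := intervalIntegral.integral_comp_neg (a := 0) (b := x) fun t : ℝ => Real.exp (-t ^ 2)
  simp only [even_two, Even.neg_pow, neg_zero] at h
  rw [erf, erf, h, intervalIntegral.integral_symm (-x) 0]
  ring

theorem tendsto_erf_atTop : Tendsto erf atTop (𝓝 1) := by
  have hI : IntegrableOn (fun t : ℝ => Real.exp (-t ^ 2)) (Set.Ioi 0) := by
    simpa using (integrable_exp_neg_mul_sq (b := 1) one_pos).integrableOn
  have h := (intervalIntegral_tendsto_integral_Ioi 0 hI tendsto_id).const_mul (2 / √Real.pi)
  have h2 := integral_gaussian_Ioi 1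
  simp only [neg_mul, one_mul, div_one] at h2
  rw [h2] at h
  have h3 : 2 / √Real.pi * (√Real.pi / 2) = 1 := by
    have := (Real.sqrt_pos.2 Real.pi_pos).ne'
    field_simp
  rw [h3] at h
  exact h

theorem erf_lt_one (x : ℝ) : erf x < 1 :=
  (strictMono_erf (lt_add_one x)).trans_le
    (strictMono_erf.monotone.ge_of_tendsto tendsto_erf_atTop _)

theorem neg_one_lt_erf (x : ℝ) : -1 < erf x := by
  have := erf_lt_one (-x)
  rw [erf_neg] at this
  linarith

theorem exists_erf_eq {y : ℝ} (hy : y ∈ Set.Ioo (-1 : ℝ) 1) : ∃ x, erf x = y := by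
  refine mem_range_of_exists_le_of_exists_ge continuous_erf ?_ ?_
  · obtain ⟨x, hx⟩ := (tendsto_erf_atTop.eventually (lt_mem_nhds (a := -y)
      (by linarith [hy.1]))).exists
    exact ⟨-x, by rw [erf_neg]; linarith⟩
  · obtain ⟨x, hx⟩ := (tendsto_erf_atTop.eventually (lt_mem_nhds hy.2)).exists
    exact ⟨x, hx.le⟩

theorem erfinv_erf (x : ℝ) : erfinv (erf x) = x := by
  refine IsGreatest.csSup_eq ⟨⟨x, show erf x ≤ erf x from le_rfl, rfl⟩, ?_⟩
  rintro _ ⟨t, ht, rfl⟩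
  exact EReal.coe_le_coe_iff.2 (strictMono_erf.le_iff_le.1 ht)

theorem erfinv_one : erfinv 1 = ⊤ := by
  rw [erfinv, sSup_eq_top]
  intro b hb
  obtain ⟨r, hr, -⟩ := EReal.lt_iff_exists_real_btwn.1 hb
  exact ⟨r, ⟨r, (erf_lt_one r).le, rfl⟩, hr⟩

theorem erfinv_neg_one : erfinv (-1) = ⊥ := by
  have : {t : ℝ | erf t ≤ -1} = ∅ := by
    ext t; simpa using neg_one_lt_erf t
  rw [erfinv, this]
  simp

theorem mlBound_eq_of_erf (α σ : ℝ) {a c : ℝ} (h : erf (a / √2) = -c) :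
    mlBound α σ c = √α * √(2 - 2 * c + σ ^ 2) - √(2 / Real.pi) * Real.exp (-a ^ 2 / 2) := by
  have e : (((√2 : ℝ) : EReal) * erfinv (-c)) ^ 2 / 2 = ((a ^ 2 / 2 : ℝ) : EReal) := by
    rw [← h, erfinv_erf, ← EReal.coe_mul, mul_div_cancel₀ a (by positivity : √2 ≠ 0)]
    rfl
  rw [mlBound, e, ← EReal.coe_neg, EReal.exp_coe, ENNReal.toReal_ofReal (Real.exp_pos _).le,
    neg_div]

theorem mlBound_one (α σ : ℝ) : mlBound α σ 1 = √α * √(2 - 2 * 1 + σ ^ 2) := by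
  have h : ((√2 : ℝ) : EReal) * ⊥ = ⊥ := EReal.coe_mul_bot_of_pos (by positivity)
  have h2 : (⊤ : EReal) / 2 = ⊤ := EReal.top_div_of_pos_ne_top (by norm_num) (by decide)
  simp [mlBound, erfinv_neg_one, h, sq, h2]

theorem mlBound_neg_one (α σ : ℝ) : mlBound α σ (-1) = √α * √(2 - 2 * (-1) + σ ^ 2) := by
  have h : ((√2 : ℝ) : EReal) * ⊤ = ⊤ := EReal.coe_mul_top_of_pos (by positivity)
  have h2 : (⊤ : EReal) / 2 = ⊤ := EReal.top_div_of_pos_ne_top (by norm_num) (by decide)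
  simp [mlBound, erfinv_one, h, sq, h2]

end ErrorFunction

section GaussianIntegrals

theorem integrable_id_gaussianReal : Integrable (fun t : ℝ => t) (gaussianReal 0 1) :=
  (memLp_id_gaussianReal (μ := 0) (v := 1) 1).integrable (by simp)

theorem integrable_abs_add_gaussianReal (ν : ℝ) :
    Integrable (fun t : ℝ => |t + ν|) (gaussianReal 0 1) :=
  (integrable_id_gaussianReal.add (integrable_const ν)).abs

theorem setIntegral_gaussianReal_std (f : ℝ → ℝ) {s : Set ℝ} (hs : MeasurableSet s) :
    ∫ t in s, f t ∂(gaussianReal 0 1) = ∫ t in s, gaussianPDFReal 0 1 t * f t := by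
  rw [← integral_indicator hs, ← integral_indicator hs,
    integral_gaussianReal_eq_integral_smul one_ne_zero]
  congr 1; ext t
  by_cases h : t ∈ s <;> simp [h]

/-- The sign of `t + a`. -/
def signShift (a t : ℝ) : ℝ := if -a < t then 1 else -1

theorem measurable_signShift (a : ℝ) : Measurable (signShift a) :=
  Measurable.ite measurableSet_Ioi measurable_const measurable_const

theorem abs_signShift (a t : ℝ) : |signShift a t| = 1 := by
  unfold signShift; split_ifs <;> simp

theorem signShift_mul (a t : ℝ) : signShift a t * (t + a) = |t + a| := by
  unfold signShift; split_ifs with h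
  · rw [abs_of_pos (by linarith), one_mul]
  · rw [abs_of_nonpos (by linarith)]; ring

theorem integrable_signShift_mul (a : ℝ) {f : ℝ → ℝ} (hf : Integrable f (gaussianReal 0 1)) :
    Integrable (fun t => signShift a t * f t) (gaussianReal 0 1) :=
  hf.bdd_mul (c := 1) (measurable_signShift a).aestronglyMeasurable
    (Eventually.of_forall fun t => (abs_signShift a t).le)

theorem integral_signShift_mul (a : ℝ) {f : ℝ → ℝ} (hf : Integrable f (gaussianReal 0 1)) :
    ∫ t, signShift a t * f t ∂(gaussianReal 0 1) =
      2 * (∫ t in Set.Ioi (-a), gaussianPDFReal 0 1 t * f t) - ∫ t, f t ∂(gaussianReal 0 1) := by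
  rw [← setIntegral_gaussianReal_std f measurableSet_Ioi, ← integral_indicator measurableSet_Ioi,
    ← integral_const_mul, ← integral_sub ((hf.indicator measurableSet_Ioi).const_mul 2) hf]
  congr 1; ext t
  by_cases h : -a < t
  · simp [signShift, h]; ring
  · simp [signShift, h]

theorem tendsto_gaussianPDFReal_atTop : Tendsto (gaussianPDFReal 0 1) atTop (𝓝 0) := by
  have h2 : gaussianPDFReal 0 1 = fun t : ℝ => (√(2 * Real.pi))⁻¹ * Real.exp (-t ^ 2 / 2) :=
    funext gaussianPDFReal_std
  rw [h2, ← mul_zero (√(2 * Real.pi))⁻¹]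
  refine Tendsto.const_mul _ (Real.tendsto_exp_atBot.comp ?_)
  have : Tendsto (fun t : ℝ => t ^ 2 / 2) atTop atTop :=
    (tendsto_pow_atTop two_ne_zero).atTop_div_const two_pos
  simpa [neg_div, Function.comp_def] using tendsto_neg_atTop_atBot.comp this

theorem two_mul_gaussianPDFReal_std (a : ℝ) :
    2 * gaussianPDFReal 0 1 a = √(2 / Real.pi) * Real.exp (-a ^ 2 / 2) := by
  rw [gaussianPDFReal_std, ← mul_assoc]
  congr 1
  have h := Real.sqrt_pos.2 Real.pi_pos
  have h2 : (0 : ℝ) < √2 := by positivity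
  rw [Real.sqrt_mul (by norm_num), Real.sqrt_div (by norm_num)]
  field_simp
  exact (Real.sq_sqrt (by norm_num)).symm

theorem integral_signShift_mul_id (a : ℝ) :
    ∫ t, signShift a t * t ∂(gaussianReal 0 1) =
      √(2 / Real.pi) * Real.exp (-a ^ 2 / 2) := by
  rw [integral_signShift_mul a integrable_id_gaussianReal, integral_id_gaussianReal, sub_zero,
    ← two_mul_gaussianPDFReal_std]
  have h := integral_Ioi_of_hasDerivAt_of_tendsto (a := -a) (m := 0)
    (f := fun t => -gaussianPDFReal 0 1 t) (f' := fun t => gaussianPDFReal 0 1 t * t)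
    (hasDerivAt_gaussianPDFReal_std _).neg.continuousAt.continuousWithinAt
    (fun t _ => by
      simpa [mul_comm] using (hasDerivAt_gaussianPDFReal_std t).fun_neg)
    (by simpa [mul_comm] using integrable_mul_gaussianPDFReal_std.integrableOn)
    (by simpa using tendsto_gaussianPDFReal_atTop.neg)
  rw [h]
  simp [gaussianPDFReal_std]

theorem integral_signShift (a : ℝ) :
    ∫ t, signShift a t ∂(gaussianReal 0 1) = erf (a / √2) := by
  have h := integral_signShift_mul a (f := fun _ => 1) (integrable_const _)
  simp only [mul_one] at h
  rw [h]
  have hI : ∀ b, IntegrableOn (gaussianPDFReal 0 1) (Set.Ioi b) := fun b =>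
    (integrable_gaussianPDFReal 0 1).integrableOn
  rw [← intervalIntegral.integral_interval_add_Ioi (hI (-a)) (hI 0)]
  have h0 : ∫ t in Set.Ioi (0 : ℝ), gaussianPDFReal 0 1 t = 1 / 2 := by
    simp_rw [gaussianPDFReal_std]
    rw [integral_const_mul]
    have := integral_gaussian_Ioi (1 / 2)
    have e : ∀ x : ℝ, -(1 / 2) * x ^ 2 = -x ^ 2 / 2 := fun x => by ring
    simp_rw [e] at this
    rw [this, show Real.pi / (1 / 2) = 2 * Real.pi by ring]
    have := (Real.sqrt_pos.2 Real.two_pi_pos).ne'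
    field_simp
  have h1 : ∫ t in (-a)..0, gaussianPDFReal 0 1 t = ∫ t in (0 : ℝ)..a, gaussianPDFReal 0 1 t := by
    have := intervalIntegral.integral_comp_neg (a := 0) (b := a) (gaussianPDFReal 0 1)
    rw [neg_zero] at this
    rw [← this]
    simp [gaussianPDFReal_std]
  have h2 : ∫ t in (0 : ℝ)..a, gaussianPDFReal 0 1 t =
      (√Real.pi)⁻¹ * ∫ t in (0 : ℝ)..(a / √2), Real.exp (-t ^ 2) := by
    have := intervalIntegral.integral_comp_div (a := 0) (b := a) (c := √2)
      (fun t : ℝ => Real.exp (-t ^ 2)) (by positivity)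
    simp only [div_pow, Real.sq_sqrt (by norm_num : (0 : ℝ) ≤ 2), zero_div, smul_eq_mul] at this
    simp_rw [gaussianPDFReal_std, intervalIntegral.integral_const_mul, neg_div]
    rw [this, Real.sqrt_mul (by norm_num)]
    have h := (Real.sqrt_pos.2 Real.pi_pos).ne'
    have h2 : √(2 : ℝ) ≠ 0 := by positivity
    field_simp
  rw [h0, h1, h2, erf]
  simp
  ring

theorem integral_abs_add_ge (a ν : ℝ) :
    ν * erf (a / √2) + √(2 / Real.pi) * Real.exp (-a ^ 2 / 2) ≤
      ∫ t, |t + ν| ∂(gaussianReal 0 1) := by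
  have e : ∫ t, (signShift a t * t + ν * signShift a t) ∂(gaussianReal 0 1) =
      ν * erf (a / √2) + √(2 / Real.pi) * Real.exp (-a ^ 2 / 2) := by
    have hi : Integrable (signShift a) (gaussianReal 0 1) := by
      simpa using integrable_signShift_mul a (f := fun _ => 1) (integrable_const _)
    rw [integral_add (integrable_signShift_mul a integrable_id_gaussianReal) (hi.const_mul ν),
      integral_const_mul, integral_signShift, integral_signShift_mul_id, add_comm]
  rw [← e]
  refine integral_mono ?_ (integrable_abs_add_gaussianReal ν) fun t => ?_
  · have hi : Integrable (signShift a) (gaussianReal 0 1) := by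
      simpa using integrable_signShift_mul a (f := fun _ => 1) (integrable_const _)
    exact (integrable_signShift_mul a integrable_id_gaussianReal).add (hi.const_mul ν)
  · have h1 : signShift a t * t + ν * signShift a t = signShift a t * (t + ν) := by ring
    simp only [h1]
    refine (le_abs_self _).trans ?_
    rw [abs_mul, abs_signShift, one_mul]

theorem integral_abs_add_eq (a : ℝ) :
    ∫ t, |t + a| ∂(gaussianReal 0 1) =
      a * erf (a / √2) + √(2 / Real.pi) * Real.exp (-a ^ 2 / 2) := by
  have hi : Integrable (signShift a) (gaussianReal 0 1) := by
    simpa using integrable_signShift_mul a (f := fun _ => 1) (integrable_const _)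
  have e : ∀ t, |t + a| = signShift a t * t + a * signShift a t := fun t => by
    rw [← signShift_mul]; ring
  simp_rw [e]
  rw [integral_add (integrable_signShift_mul a integrable_id_gaussianReal) (hi.const_mul a),
    integral_const_mul, integral_signShift, integral_signShift_mul_id, add_comm]

theorem integral_abs_add_neg (ν : ℝ) :
    ∫ t, |t + -ν| ∂(gaussianReal 0 1) = ∫ t, |t + ν| ∂(gaussianReal 0 1) := by
  rw [integral_abs_add_eq, integral_abs_add_eq, neg_div, erf_neg]
  simp

theorem abs_le_integral_abs_add (ν : ℝ) : |ν| ≤ ∫ t, |t + ν| ∂(gaussianReal 0 1) := by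
  have h : ∫ t, (t + ν) ∂(gaussianReal 0 1) = ν := by
    rw [integral_add integrable_id_gaussianReal (integrable_const ν), integral_id_gaussianReal]
    simp
  calc |ν| = |∫ t, (t + ν) ∂(gaussianReal 0 1)| := by rw [h]
    _ ≤ _ := abs_integral_le_integral_abs

theorem isGreatest_range_xiRD (α σ : ℝ) {c : ℝ} (hc : c ∈ Set.Ioo (-1 : ℝ) 1) :
    IsGreatest (Set.range (xiRD α σ c)) (mlBound α σ c) := by
  obtain ⟨b, hb⟩ := exists_erf_eq (y := -c) ⟨by linarith [hc.2], by linarith [hc.1]⟩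
  have ha : erf (√2 * b / √2) = -c := by
    rw [mul_div_cancel_left₀ b (by positivity : √2 ≠ 0), hb]
  rw [mlBound_eq_of_erf α σ ha]
  constructor
  · refine ⟨√2 * b, ?_⟩
    rw [xiRD, integral_abs_add_eq, ha]
    ring
  · rintro _ ⟨ν, rfl⟩
    have := integral_abs_add_ge (√2 * b) ν
    rw [ha] at this
    rw [xiRD]
    linarith

theorem exists_integral_abs_add_lt {ε : ℝ} (hε : 0 < ε) :
    ∃ ν, 0 ≤ ν ∧ ∫ t, |t + ν| ∂(gaussianReal 0 1) < ν + ε := by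
  have h := (tendsto_gaussianPDFReal_atTop.const_mul 2).eventually
    (gt_mem_nhds (by simpa using hε)) |>.and (eventually_ge_atTop 0)
  obtain ⟨ν, h1, h2⟩ := h.exists
  refine ⟨ν, h2, ?_⟩
  rw [integral_abs_add_eq, ← two_mul_gaussianPDFReal_std]
  have := mul_le_mul_of_nonneg_left (erf_lt_one (ν / √2)).le h2
  linarith

theorem isLUB_range_xiRD (α σ : ℝ) {c : ℝ} (hc : c ∈ Set.Icc (-1 : ℝ) 1) :
    IsLUB (Set.range (xiRD α σ c)) (mlBound α σ c) := by
  by_cases h : c ∈ Set.Ioo (-1 : ℝ) 1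
  · exact (isGreatest_range_xiRD α σ h).isLUB
  have hc' : c = -1 ∨ c = 1 := by
    by_contra hne
    rw [not_or] at hne
    exact h ⟨lt_of_le_of_ne hc.1 (Ne.symm hne.1), lt_of_le_of_ne hc.2 hne.2⟩
  have hB : mlBound α σ c = √α * √(2 - 2 * c + σ ^ 2) := by
    rcases hc' with rfl | rfl
    · exact mlBound_neg_one α σ
    · exact mlBound_one α σ
  rw [hB]
  constructor
  · rintro _ ⟨ν, rfl⟩
    have h1 := abs_le_integral_abs_add ν
    have h2 := neg_abs_le ν
    have h3 := le_abs_self ν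
    rw [xiRD]
    rcases hc' with rfl | rfl <;> linarith
  · intro b hb
    refine le_of_forall_pos_lt_add fun ε hε => ?_
    obtain ⟨ν, hν, hlt⟩ := exists_integral_abs_add_lt hε
    rcases hc' with rfl | rfl
    · have := hb ⟨ν, rfl⟩
      rw [xiRD] at this
      linarith
    · have := hb ⟨-ν, rfl⟩
      rw [xiRD, integral_abs_add_neg] at this
      linarith

theorem continuous_xiRD (α σ ν : ℝ) : Continuous fun c => xiRD α σ c ν := by
  unfold xiRD; fun_prop

theorem exists_isMinOn_mlBound (α σ : ℝ) :
    ∃ c₀ ∈ Set.Icc (-1 : ℝ) 1, IsMinOn (mlBound α σ) (Set.Icc (-1 : ℝ) 1) c₀ := by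
  refine LowerSemicontinuousOn.exists_isMinOn (by simp) isCompact_Icc fun c hc y hy => ?_
  obtain ⟨_, ⟨ν, rfl⟩, hν⟩ := (lt_isLUB_iff (isLUB_range_xiRD α σ hc)).1 hy
  have h := ((continuous_xiRD α σ ν).continuousWithinAt (s := Set.Icc (-1 : ℝ) 1) (x := c))
    |>.eventually (lt_mem_nhds hν)
  filter_upwards [h, self_mem_nhdsWithin] with c' h1 h2
  exact h1.trans_le ((isLUB_range_xiRD α σ h2).1 ⟨ν, rfl⟩)

end GaussianIntegrals

section Chi

/-- The expected Euclidean norm of a standard Gaussian vector in `ℝ^m`. -/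
def chiMean (m : ℕ) : ℝ := ∫ ω, √(∑ j, ω j ^ 2) ∂(gaussPi (Fin m))

theorem integral_sq_gaussianReal : ∫ t, t ^ 2 ∂(gaussianReal 0 1) = 1 := by
  have h := variance_eq_sub (memLp_id_gaussianReal (μ := 0) (v := 1) 2)
  rw [variance_id_gaussianReal] at h
  simp [integral_id_gaussianReal] at h
  exact h.symm

theorem integrable_eval_sq_gaussPi {ι : Type*} [Fintype ι] (i : ι) :
    Integrable (fun ω : ι → ℝ => ω i ^ 2) (gaussPi ι) := by
  simpa using (memLp_eval_gaussPi i 2).integrable_sq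

theorem integrable_sqrt_sum_sq_gaussPi {ι κ : Type*} [Fintype ι] [Fintype κ] (e : κ → ι) :
    Integrable (fun ω : ι → ℝ => √(∑ j, ω (e j) ^ 2)) (gaussPi ι) := by
  refine Integrable.mono' (g := fun ω => 1 + ∑ j, ω (e j) ^ 2)
    ((integrable_const 1).add (integrable_finsetSum _ fun j _ => integrable_eval_sq_gaussPi _))
    (Continuous.aestronglyMeasurable (by fun_prop)) (Eventually.of_forall fun ω => ?_)
  rw [Real.norm_eq_abs, abs_of_nonneg (Real.sqrt_nonneg _), Real.sqrt_le_iff]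
  have : 0 ≤ ∑ j, ω (e j) ^ 2 := by positivity
  exact ⟨by positivity, by nlinarith⟩

theorem integral_sum_sq_gaussPi (m : ℕ) : ∫ ω, ∑ j, ω j ^ 2 ∂(gaussPi (Fin m)) = m := by
  rw [integral_finsetSum _ fun j _ => integrable_eval_sq_gaussPi j]
  have : ∀ j : Fin m, ∫ ω, ω j ^ 2 ∂(gaussPi (Fin m)) = 1 := fun j => by
    rw [← integral_sq_gaussianReal, ← (measurePreserving_eval_gaussPi j).map_eq,
      integral_map (measurePreserving_eval_gaussPi j).measurable.aemeasurable
        (Continuous.aestronglyMeasurable (by fun_prop))]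
  simp [this]

theorem memLp_sq_gaussianReal : MemLp (fun t : ℝ => t ^ 2) 2 (gaussianReal 0 1) := by
  rw [memLp_two_iff_integrable_sq (Continuous.aestronglyMeasurable (by fun_prop))]
  have h := (memLp_id_gaussianReal (μ := 0) (v := 1) 4).integrable_norm_pow (p := 4) (by simp)
  refine h.congr (Eventually.of_forall fun t => ?_)
  simp only [id, Real.norm_eq_abs, ← pow_mul]
  exact Even.pow_abs (by decide) t

theorem integrable_sq_sum_sq_sub (m : ℕ) :
    Integrable (fun ω : Fin m → ℝ => (∑ j, ω j ^ 2 - m) ^ 2) (gaussPi (Fin m)) := by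
  have h : MemLp (fun ω : Fin m → ℝ => ∑ j, ω j ^ 2 - m) 2 (gaussPi (Fin m)) :=
    (memLp_finsetSum _ fun j _ => memLp_sq_gaussianReal.comp_measurePreserving
      (measurePreserving_eval_gaussPi j)).sub (memLp_const _)
  exact h.integrable_sq

theorem integral_sq_sum_sq_sub (m : ℕ) :
    ∫ ω, (∑ j, ω j ^ 2 - m) ^ 2 ∂(gaussPi (Fin m)) =
      m * variance (fun t : ℝ => t ^ 2) (gaussianReal 0 1) := by
  have h := variance_sum_pi (μ := fun _ : Fin m => gaussianReal 0 1)
    (X := fun _ t => t ^ 2) fun _ => memLp_sq_gaussianReal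
  rw [variance_eq_integral (Measurable.aemeasurable (by fun_prop))] at h
  simp only [Finset.sum_apply, Finset.sum_const, Finset.card_univ, Fintype.card_fin,
    nsmul_eq_mul] at h
  rw [← h]
  have e := integral_sum_sq_gaussPi m
  unfold gaussPi at e ⊢
  rw [e]

theorem sqrt_lower_bound {y : ℝ} (hy : 0 ≤ y) : 1 + (y - 1) / 2 - (y - 1) ^ 2 / 2 ≤ √y := by
  obtain ⟨r, hr, rfl⟩ : ∃ r : ℝ, 0 ≤ r ∧ y = r ^ 2 := ⟨√y, Real.sqrt_nonneg _, (Real.sq_sqrt hy).symm⟩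
  rw [Real.sqrt_sq hr]
  nlinarith [mul_nonneg (sq_nonneg (r - 1)) (by positivity : 0 ≤ r ^ 2 + 2 * r)]

theorem sqrt_upper_bound {y : ℝ} (hy : 0 ≤ y) : √y ≤ 1 + (y - 1) / 2 := by
  rw [Real.sqrt_le_iff]
  exact ⟨by linarith, by nlinarith [sq_nonneg (y - 1)]⟩

theorem chiMean_bounds {m : ℕ} (hm : 0 < m) :
    1 - variance (fun t : ℝ => t ^ 2) (gaussianReal 0 1) / (2 * m) ≤ chiMean m / √m ∧
      chiMean m / √m ≤ 1 := by
  have hm' : (0 : ℝ) < m := by exact_mod_cast hm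
  have e : chiMean m / √m = ∫ ω, √((∑ j, ω j ^ 2) / m) ∂(gaussPi (Fin m)) := by
    rw [chiMean, ← integral_div]
    simp_rw [Real.sqrt_div' _ hm'.le]
  have hI0 := integrable_finsetSum (μ := gaussPi (Fin m)) Finset.univ
    fun (j : Fin m) _ => integrable_eval_sq_gaussPi j
  have hI : Integrable (fun ω : Fin m → ℝ => √((∑ j, ω j ^ 2) / m)) (gaussPi (Fin m)) := by
    simp_rw [Real.sqrt_div' _ hm'.le]
    exact (integrable_sqrt_sum_sq_gaussPi fun j => j).div_const _
  have hI1 : Integrable (fun ω : Fin m → ℝ => 1 + ((∑ j, ω j ^ 2) / m - 1) / 2)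
      (gaussPi (Fin m)) :=
    (integrable_const _).add (((hI0.div_const _).sub (integrable_const _)).div_const _)
  have hv1 : ∫ ω, (1 + ((∑ j, ω j ^ 2) / m - 1) / 2) ∂(gaussPi (Fin m)) = 1 := by
    have hlin : ∀ ω : Fin m → ℝ, 1 + ((∑ j, ω j ^ 2) / m - 1) / 2
        = 1 / 2 + (∑ j, ω j ^ 2) / (2 * m) := fun ω => by field_simp; ring
    simp_rw [hlin]
    rw [integral_add (integrable_const _) (hI0.div_const _), integral_const, integral_div,
      integral_sum_sq_gaussPi]
    simp
    field_simp
    norm_num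
  have hI2 := integrable_sq_sum_sq_sub m
  rw [e]
  constructor
  · have hsq : ∀ ω : Fin m → ℝ, ((∑ j, ω j ^ 2) / m - 1) ^ 2 / 2
        = (∑ j, ω j ^ 2 - m) ^ 2 / (2 * (m : ℝ) ^ 2) := fun ω => by field_simp
    have hv2 : ∫ ω, (1 + ((∑ j, ω j ^ 2) / m - 1) / 2 - ((∑ j, ω j ^ 2) / m - 1) ^ 2 / 2)
        ∂(gaussPi (Fin m)) = 1 - variance (fun t : ℝ => t ^ 2) (gaussianReal 0 1) / (2 * m) := by
      simp_rw [hsq]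
      rw [integral_sub hI1 (hI2.div_const _), hv1, integral_div, integral_sq_sum_sq_sub]
      field_simp
    rw [← hv2]
    refine integral_mono ?_ hI fun ω => sqrt_lower_bound (by positivity)
    simp_rw [hsq]
    exact hI1.sub (hI2.div_const _)
  · rw [← hv1]
    exact integral_mono hI hI1 fun ω => sqrt_upper_bound (by positivity)

theorem tendsto_chiMean_div_sqrt {α : ℝ} (hα : 0 < α) {m : ℕ → ℕ}
    (hm : Tendsto (fun n => (m n : ℝ) / (n : ℝ)) atTop (𝓝 α)) :
    Tendsto (fun n : ℕ => chiMean (m n) / √(n : ℝ)) atTop (𝓝 √α) := by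
  have hpos : ∀ᶠ n in atTop, 0 < m n := by
    filter_upwards [hm.eventually (lt_mem_nhds hα)] with n hn
    rcases Nat.eq_zero_or_pos (m n) with h | h
    · simp [h] at hn
    · exact h
  have hmt : Tendsto (fun n => (m n : ℝ)) atTop atTop := by
    have h := hm.pos_mul_atTop hα (tendsto_natCast_atTop_atTop (R := ℝ))
    refine h.congr' ?_
    filter_upwards [eventually_gt_atTop 0] with n hn
    have : (n : ℝ) ≠ 0 := by exact_mod_cast hn.ne'
    field_simp
  have h1 : Tendsto (fun n => chiMean (m n) / √(m n : ℝ)) atTop (𝓝 1) := by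
    refine tendsto_of_tendsto_of_tendsto_of_le_of_le'
      (g := fun n => 1 - variance (fun t : ℝ => t ^ 2) (gaussianReal 0 1) / (2 * (m n : ℝ)))
      ?_ tendsto_const_nhds (hpos.mono fun n hn => (chiMean_bounds hn).1)
      (hpos.mono fun n hn => (chiMean_bounds hn).2)
    have : Tendsto (fun n => 2 * (m n : ℝ)) atTop atTop := hmt.const_mul_atTop two_pos
    simpa using (this.const_div_atTop
      (variance (fun t : ℝ => t ^ 2) (gaussianReal 0 1))).const_sub 1
  have h2 := h1.mul ((Real.continuous_sqrt.tendsto α).comp hm)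
  rw [one_mul] at h2
  refine h2.congr' ?_
  filter_upwards [hpos] with n hn
  have : √(m n : ℝ) ≠ 0 := (Real.sqrt_pos.2 (by exact_mod_cast hn)).ne'
  simp only [Function.comp_apply]
  rw [Real.sqrt_div (by positivity)]
  field_simp

end Chi

section Expect

variable {Ω : Type*} [MeasurableSpace Ω] {μ : Measure Ω}

theorem expect_mono {f g : Ω → EReal} (h : ∀ ω, f ω ≤ g ω) : expect μ f ≤ expect μ g := by
  refine EReal.sub_le_sub ?_ ?_
  · exact EReal.coe_ennreal_le_coe_ennreal_iff.2
      (lintegral_mono fun ω => EReal.toENNReal_le_toENNReal (h ω))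
  · exact EReal.coe_ennreal_le_coe_ennreal_iff.2
      (lintegral_mono fun ω => EReal.toENNReal_le_toENNReal (EReal.neg_le_neg_iff.2 (h ω)))

theorem expect_coe {f : Ω → ℝ} (hf : Integrable f μ) :
    expect μ (fun ω => (f ω : EReal)) = ((∫ ω, f ω ∂μ : ℝ) : EReal) := by
  have h1 := hf.lintegral_lt_top.ne
  have h2 := hf.neg.lintegral_lt_top.ne
  simp only [Pi.neg_apply] at h2
  simp only [expect, ← EReal.coe_neg, EReal.toENNReal_of_ne_top (EReal.coe_ne_top _),
    EReal.toReal_coe]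
  rw [integral_eq_lintegral_pos_part_sub_lintegral_neg_part hf, EReal.coe_sub,
    EReal.coe_ennreal_toReal h1, EReal.coe_ennreal_toReal h2]

theorem expect_top [IsProbabilityMeasure μ] : expect μ (fun _ => (⊤ : EReal)) = ⊤ := by
  simp [expect]

end Expect

section Sphere

variable {m : ℕ}

theorem dotProduct_le_sqrt {l : EuclideanSpace ℝ (Fin m)}
    (hl : l ∈ Metric.sphere (0 : EuclideanSpace ℝ (Fin m)) 1) (g : Fin m → ℝ) :
    l.ofLp ⬝ᵥ g ≤ √(∑ j, g j ^ 2) := by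
  have hl2 : ∑ j, l j ^ 2 = 1 := by
    have h : ‖l‖ = 1 := by simpa using hl
    rw [EuclideanSpace.norm_eq, Real.sqrt_eq_one] at h
    simpa using h
  refine Real.le_sqrt_of_sq_le ?_
  have := Finset.sum_mul_sq_le_sq_mul_sq Finset.univ l g
  rw [hl2, one_mul] at this
  exact this

theorem exists_dotProduct_eq_sqrt (hm : 0 < m) (g : Fin m → ℝ) :
    ∃ l ∈ Metric.sphere (0 : EuclideanSpace ℝ (Fin m)) 1, l.ofLp ⬝ᵥ g = √(∑ j, g j ^ 2) := by
  set N := √(∑ j, g j ^ 2) with hN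
  have hNsq : N ^ 2 = ∑ j, g j ^ 2 := Real.sq_sqrt (by positivity)
  rcases eq_or_ne N 0 with h0 | h0
  · have hg : g = 0 := by
      rw [h0, zero_pow two_ne_zero, eq_comm,
        Finset.sum_eq_zero_iff_of_nonneg fun _ _ => sq_nonneg _] at hNsq
      funext j
      simpa using hNsq j (Finset.mem_univ j)
    exact ⟨EuclideanSpace.single ⟨0, hm⟩ 1, by simp, by simp [hg, h0]⟩
  · refine ⟨WithLp.toLp 2 fun j => g j / N, ?_, ?_⟩
    · rw [mem_sphere_zero_iff_norm, EuclideanSpace.norm_eq, Real.sqrt_eq_one]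
      simp only [Real.norm_eq_abs, sq_abs, div_pow, ← Finset.sum_div, ← hNsq]
      exact div_self (pow_ne_zero 2 h0)
    · simp only [dotProduct, div_mul_eq_mul_div, ← sq, ← Finset.sum_div, ← hNsq]
      field_simp

theorem iSup_sphere (hm : 0 < m) (g : Fin m → ℝ) {t : ℝ} (ht : 0 ≤ t) (b e : ℝ) :
    ⨆ l ∈ Metric.sphere (0 : EuclideanSpace ℝ (Fin m)) 1,
      (((l.ofLp ⬝ᵥ g) * t - ‖l‖ * b + e : ℝ) : EReal) =
    ((√(∑ j, g j ^ 2) * t - b + e : ℝ) : EReal) := by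
  refine le_antisymm (iSup₂_le fun l hl => ?_) ?_
  · have h : ‖l‖ = 1 := by simpa using hl
    rw [h, one_mul, EReal.coe_le_coe_iff]
    have := mul_le_mul_of_nonneg_right (dotProduct_le_sqrt hl g) ht
    linarith
  · obtain ⟨l, hl, he⟩ := exists_dotProduct_eq_sqrt hm g
    have h : ‖l‖ = 1 := by simpa using hl
    refine le_iSup₂_of_le l hl ?_
    rw [h, one_mul, he]

end Sphere

section Binary

variable {n : ℕ}

theorem inner_eq_sum (s x : EuclideanSpace ℝ (Fin n)) : inner ℝ s x = ∑ i, s i * x i := by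
  simp [PiLp.inner_apply, mul_comm]

theorem sq_of_mem_binarySet {x : EuclideanSpace ℝ (Fin n)} (hx : x ∈ binarySet n) (i : Fin n) :
    x i ^ 2 = 1 / n := by
  have h : (√(n : ℝ)) ^ 2 = n := Real.sq_sqrt (Nat.cast_nonneg n)
  rcases hx i with h1 | h1 <;> rw [h1]
  · rw [div_pow, h, one_pow]
  · rw [neg_sq, div_pow, h, one_pow]

theorem sum_sq_of_mem_binarySet (hn : 0 < n) {x : EuclideanSpace ℝ (Fin n)}
    (hx : x ∈ binarySet n) : ∑ i, x i ^ 2 = 1 := by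
  have : (n : ℝ) ≠ 0 := by exact_mod_cast hn.ne'
  simp [sq_of_mem_binarySet hx, this]

theorem sum_sub_sq_of_mem_binarySet (hn : 0 < n) {s x : EuclideanSpace ℝ (Fin n)}
    (hs : s ∈ binarySet n) (hx : x ∈ binarySet n) :
    ∑ i, (s i - x i) ^ 2 = 2 - 2 * inner ℝ s x := by
  have h : ∀ i, (s i - x i) ^ 2 = s i ^ 2 + x i ^ 2 - 2 * (s i * x i) := fun i => by ring
  simp_rw [h]
  rw [Finset.sum_sub_distrib, Finset.sum_add_distrib, ← Finset.mul_sum,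
    sum_sq_of_mem_binarySet hn hs, sum_sq_of_mem_binarySet hn hx, inner_eq_sum]
  norm_num

theorem norm_sub_sq_of_mem_binarySet (hn : 0 < n) {s x : EuclideanSpace ℝ (Fin n)}
    (hs : s ∈ binarySet n) (hx : x ∈ binarySet n) :
    ‖s - x‖ ^ 2 = 2 - 2 * inner ℝ s x := by
  rw [EuclideanSpace.norm_sq_eq, ← sum_sub_sq_of_mem_binarySet hn hs hx]
  simp

theorem sqrt_mul_of_mem_binarySet (hn : 0 < n) {x : EuclideanSpace ℝ (Fin n)}
    (hx : x ∈ binarySet n) (i : Fin n) : √(n : ℝ) * x i = 1 ∨ √(n : ℝ) * x i = -1 := by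
  have : √(n : ℝ) ≠ 0 := (Real.sqrt_pos.2 (by exact_mod_cast hn)).ne'
  rcases hx i with h | h <;> rw [h]
  · left; field_simp
  · right; field_simp

theorem abs_of_mem_binarySet {x : EuclideanSpace ℝ (Fin n)} (hx : x ∈ binarySet n) (i : Fin n) :
    |x i| = 1 / √(n : ℝ) := by
  have : 0 ≤ 1 / √(n : ℝ) := by positivity
  rcases hx i with h | h <;> rw [h]
  · exact abs_of_nonneg this
  · rw [abs_neg, abs_of_nonneg this]

theorem le_sum_mul_of_mem_binarySet {x : EuclideanSpace ℝ (Fin n)} (hx : x ∈ binarySet n)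
    (u : Fin n → ℝ) : -(1 / √(n : ℝ) * ∑ i, |u i|) ≤ ∑ i, x i * u i := by
  rw [Finset.mul_sum, ← Finset.sum_neg_distrib]
  refine Finset.sum_le_sum fun i _ => ?_
  rw [← abs_of_mem_binarySet hx i, ← abs_mul]
  exact neg_abs_le _

theorem exists_sum_mul_eq_of_binarySet (u : Fin n → ℝ) :
    ∃ x ∈ binarySet n, ∑ i, x i * u i = -(1 / √(n : ℝ) * ∑ i, |u i|) := by
  refine ⟨WithLp.toLp 2 fun i => if 0 ≤ u i then -(1 / √(n : ℝ)) else 1 / √(n : ℝ),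
    fun i => ?_, ?_⟩
  · by_cases h : 0 ≤ u i <;> simp [h]
  · rw [Finset.mul_sum, ← Finset.sum_neg_distrib]
    refine Finset.sum_congr rfl fun i _ => ?_
    by_cases h : 0 ≤ u i
    · simp [h, abs_of_nonneg h]
    · simp [h, abs_of_neg (not_le.1 h)]

theorem finite_binarySet (n : ℕ) : (binarySet n).Finite := by
  have h : (Set.univ.pi fun _ : Fin n => ({1 / √(n : ℝ), -(1 / √(n : ℝ))} : Set ℝ)).Finite :=
    Set.Finite.pi fun _ => Set.toFinite _
  refine (h.preimage (WithLp.ofLp_injective 2).injOn).subset fun x hx => ?_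
  exact fun i _ => hx i

end Binary

section Dual

variable {m n : ℕ}

theorem dualObj_eq (hm : 0 < m) (d : EuclideanSpace ℝ (Fin n) → ℝ) (σ : ℝ)
    (s : EuclideanSpace ℝ (Fin n)) (c ν : ℝ) (g : Fin m → ℝ) (h : Fin n → ℝ) (h₀ : ℝ) :
    dualObj d σ s c ν g h h₀ = ⨅ x ∈ binarySet n,
      ((√(∑ j, g j ^ 2) * √(d x + σ ^ 2) - (∑ i, h i * (s i - x i) + h₀ * σ) +
        √(n : ℝ) * ν * (inner ℝ s x - c) : ℝ) : EReal) := by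
  unfold dualObj
  refine iInf_congr fun x => iInf_congr fun _ => ?_
  rw [iSup_sphere hm g (Real.sqrt_nonneg _)]
  simp [dotProduct]

theorem dualObj_const_eq (hm : 0 < m) (d σ : ℝ) (s : EuclideanSpace ℝ (Fin n)) (c ν : ℝ)
    (g : Fin m → ℝ) (h : Fin n → ℝ) (h₀ : ℝ) :
    dualObj (fun _ => d) σ s c ν g h h₀ =
      ((√(∑ j, g j ^ 2) * √(d + σ ^ 2) - (∑ i, s i * h i + h₀ * σ) -
        (1 / √(n : ℝ) * ∑ i, |h i + √(n : ℝ) * ν * s i| + √(n : ℝ) * ν * c) : ℝ) : EReal) := by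
  rw [dualObj_eq hm]
  have e : ∀ x : EuclideanSpace ℝ (Fin n), ∑ i, x i * (h i + √(n : ℝ) * ν * s i) =
      ∑ i, s i * h i - ∑ i, h i * (s i - x i) + √(n : ℝ) * ν * inner ℝ s x := by
    intro x
    rw [inner_eq_sum, Finset.mul_sum, ← Finset.sum_sub_distrib, ← Finset.sum_add_distrib]
    exact Finset.sum_congr rfl fun i _ => by ring
  refine le_antisymm ?_ (le_iInf₂ fun x hx => ?_)
  · obtain ⟨x, hx, hxe⟩ := exists_sum_mul_eq_of_binarySet fun i => h i + √(n : ℝ) * ν * s i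
    refine iInf₂_le_of_le x hx (EReal.coe_le_coe_iff.2 ?_)
    have := e x
    simp only at hxe
    linarith
  · refine EReal.coe_le_coe_iff.2 ?_
    have h1 := le_sum_mul_of_mem_binarySet hx fun i => h i + √(n : ℝ) * ν * s i
    have := e x
    simp only at h1
    linarith

theorem integral_comp_sign_mul {ε : ℝ} (hε : ε = 1 ∨ ε = -1) (f : ℝ → ℝ) :
    ∫ t, f (ε * t) ∂(gaussianReal 0 1) = ∫ t, f t ∂(gaussianReal 0 1) := by
  rcases hε with rfl | rfl
  · simp
  · have h : (gaussianReal 0 1).map (MeasurableEquiv.neg ℝ) = gaussianReal 0 1 := by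
      have := gaussianReal_map_neg (μ := 0) (v := 1)
      rw [neg_zero] at this
      exact this
    conv_rhs => rw [← h, integral_map_equiv]
    simp

theorem integral_eval_gaussPi {ι : Type*} [Fintype ι] (i : ι) {f : ℝ → ℝ} (hf : Measurable f) :
    ∫ ω, f (ω i) ∂(gaussPi ι) = ∫ t, f t ∂(gaussianReal 0 1) := by
  rw [← (measurePreserving_eval_gaussPi i).map_eq,
    integral_map (measurePreserving_eval_gaussPi i).measurable.aemeasurable
      hf.aestronglyMeasurable]

theorem integrable_comp_eval_gaussPi {ι : Type*} [Fintype ι] (i : ι) {f : ℝ → ℝ}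
    (hf : Integrable f (gaussianReal 0 1)) : Integrable (fun ω => f (ω i)) (gaussPi ι) :=
  (measurePreserving_eval_gaussPi i).integrable_comp_of_integrable hf

theorem integrable_comp_sign_mul {ε : ℝ} (hε : ε = 1 ∨ ε = -1) {f : ℝ → ℝ}
    (hf : Integrable f (gaussianReal 0 1)) :
    Integrable (fun t => f (ε * t)) (gaussianReal 0 1) := by
  rcases hε with rfl | rfl
  · simpa using hf
  · have h : MeasurePreserving (fun t : ℝ => -t) (gaussianReal 0 1) (gaussianReal 0 1) :=
      ⟨measurable_neg, by simpa using gaussianReal_map_neg (μ := 0) (v := 1)⟩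
    simpa [Function.comp_def] using h.integrable_comp_of_integrable hf

theorem integral_sum_mul_eval_gaussPi {ι κ : Type*} [Fintype ι] [Fintype κ] (s : κ → ℝ)
    (e : κ → ι) : ∫ ω, ∑ i, s i * ω (e i) ∂(gaussPi ι) = 0 := by
  rw [integral_finsetSum _ fun i _ => (integrable_eval_gaussPi (e i)).const_mul _]
  refine Finset.sum_eq_zero fun i _ => ?_
  rw [integral_const_mul, integral_eval_gaussPi (e i) (f := fun t => t) measurable_id,
    integral_id_gaussianReal, mul_zero]

theorem integrable_sum_abs {ι κ : Type*} [Fintype ι] [Fintype κ] (a : κ → ℝ) (e : κ → ι) :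
    Integrable (fun ω : ι → ℝ => ∑ i, |ω (e i) + a i|) (gaussPi ι) :=
  integrable_finsetSum _ fun i _ => ((integrable_eval_gaussPi (e i)).add (integrable_const _)).abs

theorem integral_sum_abs {ι : Type*} [Fintype ι] (hn : 0 < n) {s : EuclideanSpace ℝ (Fin n)}
    (hs : s ∈ binarySet n) (ν : ℝ) (e : Fin n → ι) :
    ∫ ω, ∑ i, |ω (e i) + √(n : ℝ) * ν * s i| ∂(gaussPi ι) =
      n * ∫ t, |t + ν| ∂(gaussianReal 0 1) := by
  have hi : ∀ i, Integrable (fun ω : ι → ℝ => |ω (e i) + √(n : ℝ) * ν * s i|) (gaussPi ι) :=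
    fun i => ((integrable_eval_gaussPi (e i)).add (integrable_const _)).abs
  rw [integral_finsetSum _ fun i _ => hi i]
  have h : ∀ i, ∫ ω, |ω (e i) + √(n : ℝ) * ν * s i| ∂(gaussPi ι) =
      ∫ t, |t + ν| ∂(gaussianReal 0 1) := by
    intro i
    have hε := sqrt_mul_of_mem_binarySet hn hs i
    rw [integral_eval_gaussPi (e i) (f := fun t => |t + √(n : ℝ) * ν * s i|) (by fun_prop),
      ← integral_comp_sign_mul hε]
    congr 1; ext t
    rw [show √(n : ℝ) * s i * t + √(n : ℝ) * ν * s i = (√(n : ℝ) * s i) * (t + ν) by ring, abs_mul]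
    rcases hε with h | h <;> simp [h]
  simp [h]

theorem dualMeanFixed_eq (hm : 0 < m) (hn : 0 < n) (σ : ℝ) {s : EuclideanSpace ℝ (Fin n)}
    (hs : s ∈ binarySet n) (c ν : ℝ) :
    dualMeanFixed m n σ s c ν = ((chiMean m / √(n : ℝ) * √(2 - 2 * c + σ ^ 2) -
      (∫ t, |t + ν| ∂(gaussianReal 0 1)) - ν * c : ℝ) : EReal) := by
  have hn' : 0 < √(n : ℝ) := Real.sqrt_pos.2 (by exact_mod_cast hn)
  have hnn : √(n : ℝ) * √(n : ℝ) = n := Real.mul_self_sqrt (Nat.cast_nonneg n)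
  unfold dualMeanFixed dualMean
  simp_rw [dualObj_const_eq hm]
  change _ * expect ((gaussPi (Fin m)).prod ((gaussPi (Fin n)).prod (gaussianReal 0 1))) _ = _
  have i1 : Integrable (fun ω : (Fin m → ℝ) × (Fin n → ℝ) × ℝ => √(∑ j, ω.1 j ^ 2))
      ((gaussPi (Fin m)).prod ((gaussPi (Fin n)).prod (gaussianReal 0 1))) :=
    (integrable_sqrt_sum_sq_gaussPi fun j => j).comp_fst _
  have i2 : Integrable (fun ω : (Fin m → ℝ) × (Fin n → ℝ) × ℝ => ∑ i, s i * ω.2.1 i)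
      ((gaussPi (Fin m)).prod ((gaussPi (Fin n)).prod (gaussianReal 0 1))) :=
    ((integrable_finsetSum _ fun i _ =>
      (integrable_eval_gaussPi i).const_mul (s i)).comp_fst _).comp_snd _
  have i3 : Integrable (fun ω : (Fin m → ℝ) × (Fin n → ℝ) × ℝ => ω.2.2 * σ)
      ((gaussPi (Fin m)).prod ((gaussPi (Fin n)).prod (gaussianReal 0 1))) :=
    ((integrable_id_gaussianReal.mul_const σ).comp_snd (gaussPi (Fin n))).comp_snd _
  have i4 : Integrable (fun ω : (Fin m → ℝ) × (Fin n → ℝ) × ℝ =>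
      ∑ i, |ω.2.1 i + √(n : ℝ) * ν * s i|)
      ((gaussPi (Fin m)).prod ((gaussPi (Fin n)).prod (gaussianReal 0 1))) :=
    ((integrable_sum_abs (fun i => √(n : ℝ) * ν * s i) fun i => i).comp_fst _).comp_snd _
  have i5 := i2.fun_add i3
  have i6 := (i1.mul_const √(2 - 2 * c + σ ^ 2)).sub' i5
  have i7 := (i4.const_mul (1 / √(n : ℝ))).fun_add (integrable_const (√(n : ℝ) * ν * c))
  rw [expect_coe (i6.sub' i7), ← EReal.coe_mul]
  congr 1
  rw [integral_sub i6 i7,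
    integral_sub (i1.mul_const _) i5, integral_add i2 i3,
    integral_add (i4.const_mul _) (integrable_const _), integral_mul_const, integral_const_mul,
    integral_fun_fst (fun g : Fin m → ℝ => √(∑ j, g j ^ 2)),
    integral_fun_snd (fun p : (Fin n → ℝ) × ℝ => ∑ i, s i * p.1 i),
    integral_fun_snd (fun p : (Fin n → ℝ) × ℝ => p.2 * σ),
    integral_fun_snd (fun p : (Fin n → ℝ) × ℝ => ∑ i, |p.1 i + √(n : ℝ) * ν * s i|),
    integral_fun_fst (fun h : Fin n → ℝ => ∑ i, s i * h i),
    integral_fun_snd (fun t : ℝ => t * σ),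
    integral_fun_fst (fun h : Fin n → ℝ => ∑ i, |h i + √(n : ℝ) * ν * s i|),
    integral_sum_mul_eval_gaussPi s.ofLp fun i => i, integral_mul_const, integral_id_gaussianReal,
    integral_sum_abs hn hs ν fun i => i]
  simp only [probReal_univ, zero_mul, add_zero, sub_zero, integral_const, smul_eq_mul, one_mul]
  rw [← chiMean]
  generalize ∫ t, |t + ν| ∂(gaussianReal 0 1) = I
  generalize √(n : ℝ) = r at hn' hnn
  rw [← hnn]
  field_simp
  ring

/-- An upper bound for the random dual which keeps `‖s - x‖`, from the test points
`xᵢ = -sᵢ q(√n sᵢ hᵢ)`. -/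
theorem dualMeanFree_le (hm : 0 < m) (hn : 0 < n) (σ : ℝ) {s : EuclideanSpace ℝ (Fin n)}
    (hs : s ∈ binarySet n) {c ρ κ : ℝ} (ν : ℝ) {q : ℝ → ℝ} (hq : ∀ t, q t = 1 ∨ q t = -1)
    (hqm : Measurable q) (hq1 : ∫ t, q t ∂(gaussianReal 0 1) = -c)
    (hq2 : ∫ t, q t * t ∂(gaussianReal 0 1) = ρ)
    (hκ : ∀ h : Fin n → ℝ,
      √(2 - 2 * (-(1 / n * ∑ i, q (√(n : ℝ) * s i * h i))) + σ ^ 2) ≤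
      √(2 - 2 * c + σ ^ 2) - κ * (-(1 / n * ∑ i, q (√(n : ℝ) * s i * h i)) - c)) :
    dualMeanFree m n σ s c ν ≤
      ((chiMean m / √(n : ℝ) * √(2 - 2 * c + σ ^ 2) - ρ : ℝ) : EReal) := by
  have hn0 : (0 : ℝ) < n := by exact_mod_cast hn
  have hn' : 0 < √(n : ℝ) := Real.sqrt_pos.2 hn0
  have hnn : √(n : ℝ) * √(n : ℝ) = n := Real.mul_self_sqrt (Nat.cast_nonneg n)
  set S : (Fin n → ℝ) → ℝ := fun h => -(1 / n * ∑ i, q (√(n : ℝ) * s i * h i)) - c with hS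
  set H : (Fin n → ℝ) → ℝ := fun h =>
    1 / √(n : ℝ) * ∑ i, q (√(n : ℝ) * s i * h i) * (√(n : ℝ) * s i * h i) with hH
  set τ := √(2 - 2 * c + σ ^ 2) with hτ
  have hqi : Integrable q (gaussianReal 0 1) :=
    (integrable_const (1 : ℝ)).mono' hqm.aestronglyMeasurable
      (Eventually.of_forall fun t => by rcases hq t with h | h <;> simp [h])
  have hqi2 : Integrable (fun t => q t * t) (gaussianReal 0 1) :=
    integrable_id_gaussianReal.bdd_mul (c := 1) hqm.aestronglyMeasurable
      (Eventually.of_forall fun t => by rcases hq t with h | h <;> simp [h])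
  have hε := sqrt_mul_of_mem_binarySet hn hs
  have j1 : ∀ i, Integrable (fun h : Fin n → ℝ => q (√(n : ℝ) * s i * h i)) (gaussPi (Fin n)) :=
    fun i => integrable_comp_eval_gaussPi i (integrable_comp_sign_mul (hε i) hqi)
  have j2 : ∀ i, Integrable (fun h : Fin n → ℝ => q (√(n : ℝ) * s i * h i) *
      (√(n : ℝ) * s i * h i)) (gaussPi (Fin n)) := fun i =>
    integrable_comp_eval_gaussPi i (f := fun t => q (√(n : ℝ) * s i * t) * (√(n : ℝ) * s i * t))
      (integrable_comp_sign_mul (hε i) hqi2)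
  have hSi : Integrable S (gaussPi (Fin n)) :=
    ((integrable_finsetSum _ fun i _ => j1 i).const_mul _).neg.sub (integrable_const _)
  have hHi : Integrable H (gaussPi (Fin n)) :=
    (integrable_finsetSum _ fun i _ => j2 i).const_mul _
  have hS0 : ∫ h, S h ∂(gaussPi (Fin n)) = 0 := by
    simp only [hS]
    rw [integral_sub ((integrable_finsetSum _ fun i _ => j1 i).const_mul _).fun_neg
      (integrable_const _), integral_neg, integral_const_mul, integral_finsetSum _ fun i _ => j1 i]
    have : ∀ i, ∫ h : Fin n → ℝ, q (√(n : ℝ) * s i * h i) ∂(gaussPi (Fin n)) = -c := fun i => by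
      rw [integral_eval_gaussPi i (f := fun t => q (√(n : ℝ) * s i * t)) (by fun_prop),
        integral_comp_sign_mul (hε i) q, hq1]
    simp [this]
    field_simp
    ring
  have hH0 : ∫ h, H h ∂(gaussPi (Fin n)) = √(n : ℝ) * ρ := by
    rw [hH, integral_const_mul, integral_finsetSum _ fun i _ => j2 i]
    have : ∀ i, ∫ h : Fin n → ℝ, q (√(n : ℝ) * s i * h i) * (√(n : ℝ) * s i * h i)
        ∂(gaussPi (Fin n)) = ρ := fun i => by
      rw [integral_eval_gaussPi i
        (f := fun t => q (√(n : ℝ) * s i * t) * (√(n : ℝ) * s i * t)) (by fun_prop),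
        integral_comp_sign_mul (hε i) fun t => q t * t, hq2]
    simp only [this, Finset.sum_const, Finset.card_univ, Fintype.card_fin, nsmul_eq_mul]
    rw [← mul_assoc]
    congr 1
    nth_rewrite 2 [← hnn]
    field_simp
  have hle : ∀ ω : (Fin m → ℝ) × (Fin n → ℝ) × ℝ,
      dualObj (fun x => ‖s - x‖ ^ 2) σ s c ν ω.1 ω.2.1 ω.2.2 ≤
      ((√(∑ j, ω.1 j ^ 2) * τ - κ * (√(∑ j, ω.1 j ^ 2) * S ω.2.1) -
        (∑ i, s i * ω.2.1 i + ω.2.2 * σ) - H ω.2.1 + √(n : ℝ) * ν * S ω.2.1 : ℝ) : EReal) := by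
    rintro ⟨g, h, h₀⟩
    rw [dualObj_eq hm]
    set x : EuclideanSpace ℝ (Fin n) :=
      WithLp.toLp 2 fun i => -(s i * q (√(n : ℝ) * s i * h i)) with hx
    have hxmem : x ∈ binarySet n := fun i => by
      have e : x i = -(s i * q (√(n : ℝ) * s i * h i)) := rfl
      rw [e]
      rcases hq (√(n : ℝ) * s i * h i) with h1 | h1 <;> rw [h1] <;>
        rcases hs i with h2 | h2 <;> simp [h2]
    refine iInf₂_le_of_le x hxmem (EReal.coe_le_coe_iff.2 ?_)
    have hin : inner ℝ s x = -(1 / n * ∑ i, q (√(n : ℝ) * s i * h i)) := by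
      rw [inner_eq_sum, Finset.mul_sum, ← Finset.sum_neg_distrib]
      refine Finset.sum_congr rfl fun i _ => ?_
      rw [← sq_of_mem_binarySet hs i]
      simp only [hx]; ring
    have hSx : inner ℝ s x - c = S h := by rw [hin]
    have hHx : ∑ i, h i * (s i - x i) = ∑ i, s i * h i + H h := by
      simp only [hH]
      rw [Finset.mul_sum, ← Finset.sum_add_distrib]
      refine Finset.sum_congr rfl fun i _ => ?_
      simp only [hx]
      field_simp
      ring
    rw [norm_sub_sq_of_mem_binarySet hn hs hxmem, hSx, hHx]
    have := mul_le_mul_of_nonneg_left (hκ h) (Real.sqrt_nonneg (∑ j, g j ^ 2))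
    rw [← hin, hSx] at this
    simp only
    linarith
  clear_value S H
  unfold dualMeanFree dualMean
  change _ * expect ((gaussPi (Fin m)).prod ((gaussPi (Fin n)).prod (gaussianReal 0 1))) _ ≤ _
  refine (mul_le_mul_of_nonneg_left (expect_mono hle)
    (EReal.coe_nonneg.2 (inv_nonneg.2 hn'.le))).trans ?_
  have i1 : Integrable (fun ω : (Fin m → ℝ) × (Fin n → ℝ) × ℝ => √(∑ j, ω.1 j ^ 2))
      ((gaussPi (Fin m)).prod ((gaussPi (Fin n)).prod (gaussianReal 0 1))) :=
    (integrable_sqrt_sum_sq_gaussPi fun j => j).comp_fst _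
  have i2 : Integrable (fun ω : (Fin m → ℝ) × (Fin n → ℝ) × ℝ => ∑ i, s i * ω.2.1 i)
      ((gaussPi (Fin m)).prod ((gaussPi (Fin n)).prod (gaussianReal 0 1))) :=
    ((integrable_finsetSum _ fun i _ =>
      (integrable_eval_gaussPi i).const_mul (s i)).comp_fst _).comp_snd _
  have i3 : Integrable (fun ω : (Fin m → ℝ) × (Fin n → ℝ) × ℝ => ω.2.2 * σ)
      ((gaussPi (Fin m)).prod ((gaussPi (Fin n)).prod (gaussianReal 0 1))) :=
    ((integrable_id_gaussianReal.mul_const σ).comp_snd (gaussPi (Fin n))).comp_snd _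
  have i4 : Integrable (fun ω : (Fin m → ℝ) × (Fin n → ℝ) × ℝ => H ω.2.1)
      ((gaussPi (Fin m)).prod ((gaussPi (Fin n)).prod (gaussianReal 0 1))) :=
    (hHi.comp_fst _).comp_snd _
  have i5 : Integrable (fun ω : (Fin m → ℝ) × (Fin n → ℝ) × ℝ => S ω.2.1)
      ((gaussPi (Fin m)).prod ((gaussPi (Fin n)).prod (gaussianReal 0 1))) :=
    (hSi.comp_fst _).comp_snd _
  have i6 : Integrable (fun ω : (Fin m → ℝ) × (Fin n → ℝ) × ℝ =>
      √(∑ j, ω.1 j ^ 2) * S ω.2.1)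
      ((gaussPi (Fin m)).prod ((gaussPi (Fin n)).prod (gaussianReal 0 1))) :=
    (integrable_sqrt_sum_sq_gaussPi fun j => j).mul_prod (hSi.comp_fst (gaussianReal 0 1))
  have i8 := (i1.mul_const τ).sub' (i6.const_mul κ)
  have i9 := i2.fun_add i3
  have i7 := i8.sub' i9
  have i10 := i7.sub' i4
  have v6 : ∫ ω : (Fin m → ℝ) × (Fin n → ℝ) × ℝ, √(∑ j, ω.1 j ^ 2) * S ω.2.1
      ∂((gaussPi (Fin m)).prod ((gaussPi (Fin n)).prod (gaussianReal 0 1))) = 0 := by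
    rw [integral_prod_mul (fun g : Fin m → ℝ => √(∑ j, g j ^ 2))
      (fun p : (Fin n → ℝ) × ℝ => S p.1), integral_fun_fst S, hS0]
    simp
  rw [expect_coe (i10.fun_add (i5.const_mul _)), ← EReal.coe_mul, EReal.coe_le_coe_iff]
  rw [integral_add i10 (i5.const_mul _), integral_sub i7 i4,
    integral_sub i8 i9,
    integral_sub (i1.mul_const τ) (i6.const_mul κ), integral_add i2 i3, integral_mul_const,
    integral_const_mul κ, integral_const_mul (√(n : ℝ) * ν), v6,
    integral_fun_fst (fun g : Fin m → ℝ => √(∑ j, g j ^ 2)),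
    integral_fun_snd (fun p : (Fin n → ℝ) × ℝ => ∑ i, s i * p.1 i),
    integral_fun_snd (fun p : (Fin n → ℝ) × ℝ => p.2 * σ),
    integral_fun_snd (fun p : (Fin n → ℝ) × ℝ => H p.1),
    integral_fun_snd (fun p : (Fin n → ℝ) × ℝ => S p.1),
    integral_fun_fst (fun h : Fin n → ℝ => ∑ i, s i * h i),
    integral_fun_snd (fun t : ℝ => t * σ), integral_fun_fst H, integral_fun_fst S,
    integral_sum_mul_eval_gaussPi s.ofLp fun i => i, integral_mul_const, integral_id_gaussianReal,
    hS0, hH0]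
  simp only [probReal_univ, zero_mul, add_zero, sub_zero, mul_zero, smul_eq_mul, one_mul]
  rw [← chiMean]
  refine le_of_eq ?_
  field_simp

theorem dualMeanFree_le_mlBound (hm : 0 < m) (hn : 0 < n) (α σ : ℝ)
    {s : EuclideanSpace ℝ (Fin n)} (hs : s ∈ binarySet n) {c : ℝ} (hc : c ∈ Set.Icc (-1 : ℝ) 1)
    (ν : ℝ) :
    dualMeanFree m n σ s c ν ≤ ((chiMean m / √(n : ℝ) * √(2 - 2 * c + σ ^ 2) +
      (mlBound α σ c - √α * √(2 - 2 * c + σ ^ 2)) : ℝ) : EReal) := by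
  have hn0 : (n : ℝ) ≠ 0 := by exact_mod_cast hn.ne'
  by_cases hc' : c ∈ Set.Ioo (-1 : ℝ) 1
  · obtain ⟨b, hb⟩ := exists_erf_eq (y := -c) ⟨by linarith [hc'.2], by linarith [hc'.1]⟩
    have ha : erf (√2 * b / √2) = -c := by
      rw [mul_div_cancel_left₀ b (by positivity : √2 ≠ 0), hb]
    rw [mlBound_eq_of_erf α σ ha, sub_sub_cancel_left, ← sub_eq_add_neg]
    have hpos : 0 < 2 - 2 * c + σ ^ 2 := by nlinarith [hc'.2, sq_nonneg σ]
    have hτ := Real.sqrt_pos.2 hpos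
    refine dualMeanFree_le (κ := 1 / √(2 - 2 * c + σ ^ 2)) hm hn σ hs ν (q := signShift (√2 * b))
      (fun t => by unfold signShift; split_ifs <;> simp) (measurable_signShift _)
      ((integral_signShift _).trans ha) (integral_signShift_mul_id _) fun h => ?_
    set y := -(1 / (n : ℝ) * ∑ i, signShift (√2 * b) (√(n : ℝ) * s i * h i))
    have e : √(2 - 2 * c + σ ^ 2) - 1 / √(2 - 2 * c + σ ^ 2) * (y - c) =
        (2 - 2 * c + σ ^ 2 + (2 - 2 * y + σ ^ 2)) / (2 * √(2 - 2 * c + σ ^ 2)) := by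
      have h2 := Real.sq_sqrt hpos.le
      have h3 : √(2 - 2 * c + σ ^ 2) * (1 / √(2 - 2 * c + σ ^ 2)) = 1 := mul_one_div_cancel hτ.ne'
      rw [eq_div_iff (by positivity)]
      linear_combination 2 * h2 - 2 * (y - c) * h3
    rw [e, le_div_iff₀ (by positivity)]
    by_cases hy : 0 ≤ 2 - 2 * y + σ ^ 2
    · nlinarith [sq_nonneg (√(2 - 2 * c + σ ^ 2) - √(2 - 2 * y + σ ^ 2)), Real.sq_sqrt hpos.le,
        Real.sq_sqrt hy]
    · have hyabs : y ≤ 1 := by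
        have h1 : ∑ i : Fin n, -signShift (√2 * b) (√(n : ℝ) * s i * h i) ≤ ∑ _i : Fin n, (1 : ℝ) :=
          Finset.sum_le_sum fun i _ => by
            have := neg_abs_le (signShift (√2 * b) (√(n : ℝ) * s i * h i))
            rw [abs_signShift] at this
            linarith
        have h2 : y = 1 / (n : ℝ) * ∑ i : Fin n, -signShift (√2 * b) (√(n : ℝ) * s i * h i) := by
          simp only [y, Finset.sum_neg_distrib]; ring
        rw [h2, one_div, inv_mul_le_iff₀ (by positivity)]
        simpa using h1
      exact absurd (by nlinarith [sq_nonneg σ]) hy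
  · have hc1 : c = -1 ∨ c = 1 := by
      by_contra hne
      rw [not_or] at hne
      exact hc' ⟨lt_of_le_of_ne hc.1 (Ne.symm hne.1), lt_of_le_of_ne hc.2 hne.2⟩
    have hB : mlBound α σ c = √α * √(2 - 2 * c + σ ^ 2) := by
      rcases hc1 with rfl | rfl
      · exact mlBound_neg_one α σ
      · exact mlBound_one α σ
    rw [hB, sub_self, add_zero, ← sub_zero (chiMean m / √(n : ℝ) * _)]
    refine dualMeanFree_le (κ := 0) hm hn σ hs ν (q := fun _ => -c)
      (fun t => by rcases hc1 with rfl | rfl <;> simp) measurable_const (by simp)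
      (by rw [integral_const_mul, integral_id_gaussianReal, mul_zero]) fun h => ?_
    simp [hn0]

end Dual

section Primal

variable {m n : ℕ}

/-- Gluing the matrix `A` and the vector `v` into one Gaussian array. -/
def glueArray (ω : (Fin m → Fin n → ℝ) × (Fin m → ℝ)) (k : Option (Fin n) × Fin m) : ℝ :=
  k.1.elim (ω.2 k.2) fun i => ω.1 k.2 i

theorem measurePreserving_glueArray (m n : ℕ) :
    MeasurePreserving (glueArray (m := m) (n := n)) ((gaussMat m n).prod (gaussVec m))
      (gaussPi (Option (Fin n) × Fin m)) := by
  have hm : Measurable (glueArray (m := m) (n := n)) := by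
    refine measurable_pi_iff.2 fun k => ?_
    rcases k with ⟨_ | i, j⟩
    · exact (measurable_pi_apply j).comp measurable_snd
    · exact (measurable_pi_apply i).comp ((measurable_pi_apply j).comp measurable_fst)
  refine ⟨hm, ?_⟩
  symm
  refine Measure.pi_eq fun S hS => ?_
  rw [Measure.map_apply hm (MeasurableSet.univ_pi hS)]
  have hpre : glueArray (m := m) (n := n) ⁻¹' Set.univ.pi S =
      (Set.univ.pi fun j => Set.univ.pi fun i => S (some i, j)) ×ˢ
        (Set.univ.pi fun j => S (none, j)) := by
    ext ⟨A, v⟩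
    simp only [Set.mem_preimage, Set.mem_pi, Set.mem_univ, true_imp_iff, Set.mem_prod]
    constructor
    · exact fun h => ⟨fun j i => h (some i, j), fun j => h (none, j)⟩
    · rintro ⟨h1, h2⟩ ⟨_ | i, j⟩
      · exact h2 j
      · exact h1 j i
  have : SFinite (gaussVec m) := by unfold gaussVec; infer_instance
  rw [hpre, Measure.prod_prod, gaussMat, gaussVec, Measure.pi_pi, Measure.pi_pi,
    Fintype.prod_prod_type, Fintype.prod_option, mul_comm, Finset.prod_comm]
  simp_rw [Measure.pi_pi]

/-- The vector `(σ, s - x)`. -/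
def augDiff (σ : ℝ) (s x : EuclideanSpace ℝ (Fin n)) (k : Option (Fin n)) : ℝ :=
  k.elim σ fun i => s i - x i

theorem sum_augDiff_sq (hn : 0 < n) (σ : ℝ) {s x : EuclideanSpace ℝ (Fin n)}
    (hs : s ∈ binarySet n) (hx : x ∈ binarySet n) :
    ∑ k, augDiff σ s x k ^ 2 = 2 - 2 * inner ℝ s x + σ ^ 2 := by
  rw [Fintype.sum_option, ← sum_sub_sq_of_mem_binarySet hn hs hx, add_comm]
  rfl

theorem iSup_lagrangian_of_eq (hm : 0 < m) (w : Fin m → ℝ) :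
    ⨆ l ∈ Metric.sphere (0 : EuclideanSpace ℝ (Fin m)) 1, ⨆ ν : ℝ,
      ((l.ofLp ⬝ᵥ w + ν * 0 : ℝ) : EReal) = ((√(∑ j, w j ^ 2) : ℝ) : EReal) := by
  have h := iSup_sphere hm w zero_le_one 0 0
  simp only [mul_one, mul_zero, sub_zero, add_zero] at h
  simpa using h

theorem iSup_lagrangian_of_ne (hm : 0 < m) (w : Fin m → ℝ) {t : ℝ} (ht : t ≠ 0) :
    ⨆ l ∈ Metric.sphere (0 : EuclideanSpace ℝ (Fin m)) 1, ⨆ ν : ℝ,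
      ((l.ofLp ⬝ᵥ w + ν * t : ℝ) : EReal) = ⊤ := by
  obtain ⟨l, hl, -⟩ := exists_dotProduct_eq_sqrt hm w
  refine eq_top_iff.2 (le_iSup₂_of_le l hl (top_le_iff.2 ?_))
  refine EReal.eq_top_iff_forall_lt _ |>.2 fun y => ?_
  refine lt_of_lt_of_le ?_ (le_iSup _ ((y + 1 - l.ofLp ⬝ᵥ w) / t))
  rw [EReal.coe_lt_coe_iff, div_mul_cancel₀ _ ht]
  linarith

theorem matrix_residual_eq (σ : ℝ) (s x : EuclideanSpace ℝ (Fin n)) (A : Fin m → Fin n → ℝ)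
    (v : Fin m → ℝ) (j : Fin m) :
    (Matrix.of A *ᵥ (s - x).ofLp + σ • v) j =
      ∑ k, augDiff σ s x k * glueArray (A, v) (k, j) := by
  rw [Fintype.sum_option]
  simp [augDiff, glueArray, mulVec, dotProduct, mul_comm, add_comm]

theorem primalObj_eq_top (hm : 0 < m) (σ : ℝ) {s : EuclideanSpace ℝ (Fin n)} {c : ℝ}
    (h : ∀ x ∈ binarySet n, inner ℝ s x ≠ c) (A : Fin m → Fin n → ℝ) (v : Fin m → ℝ) :
    primalObj σ s c A v = ⊤ := by
  unfold primalObj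
  simp only [iInf_eq_top]
  exact fun x hx => iSup_lagrangian_of_ne hm _ (sub_ne_zero.2 (h x hx))

/-- The points of the binary set with prescribed overlap. -/
abbrev OverlapSet (s : EuclideanSpace ℝ (Fin n)) (c : ℝ) : Type :=
  {x : EuclideanSpace ℝ (Fin n) // x ∈ binarySet n ∧ inner ℝ s x = c}

instance (s : EuclideanSpace ℝ (Fin n)) (c : ℝ) : Finite (OverlapSet s c) :=
  ((finite_binarySet n).subset fun _ hx => hx.1).to_subtype

theorem primalObj_eq (hm : 0 < m) (σ : ℝ) {s : EuclideanSpace ℝ (Fin n)} {c : ℝ}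
    [Nonempty (OverlapSet s c)] (A : Fin m → Fin n → ℝ) (v : Fin m → ℝ) :
    primalObj σ s c A v = ((⨅ x : OverlapSet s c,
      √(∑ j, (∑ k, augDiff σ s x.1 k * glueArray (A, v) (k, j)) ^ 2) : ℝ) : EReal) := by
  have hval : ∀ x : OverlapSet s c, ⨆ l ∈ Metric.sphere (0 : EuclideanSpace ℝ (Fin m)) 1, ⨆ ν : ℝ,
      ((l.ofLp ⬝ᵥ (Matrix.of A *ᵥ (s - x.1).ofLp + σ • v) + ν * (inner ℝ s x.1 - c) : ℝ) : EReal)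
      = ((√(∑ j, (∑ k, augDiff σ s x.1 k * glueArray (A, v) (k, j)) ^ 2) : ℝ) : EReal) := by
    intro x
    rw [x.2.2, sub_self, iSup_lagrangian_of_eq hm]
    simp_rw [matrix_residual_eq]
  refine le_antisymm ?_ (le_iInf₂ fun x hx => ?_)
  · obtain ⟨x, hx⟩ := exists_eq_ciInf_of_finite (f := fun x : OverlapSet s c =>
      √(∑ j, (∑ k, augDiff σ s x.1 k * glueArray (A, v) (k, j)) ^ 2))
    rw [← hx, ← hval x]
    exact iInf₂_le x.1 x.2.1
  · by_cases hc : inner ℝ s x = c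
    · rw [hval ⟨x, hx, hc⟩]
      exact EReal.coe_le_coe_iff.2 (ciInf_le (Set.finite_range _).bddBelow
        (⟨x, hx, hc⟩ : OverlapSet s c))
    · rw [iSup_lagrangian_of_ne hm _ (sub_ne_zero.2 hc)]
      exact le_top

theorem integrable_iInf_sqrt {T K M : Type*} [Finite T] [Nonempty T] [Fintype K] [Fintype M]
    (z : T → K → ℝ) :
    Integrable (fun ω : K × M → ℝ => ⨅ x, √(∑ j, (∑ k, z x k * ω (k, j)) ^ 2))
      (gaussPi (K × M)) := by
  obtain ⟨x₀⟩ := ‹Nonempty T›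
  refine Integrable.mono' (g := fun ω => ∑ j, ∑ k, |z x₀ k * ω (k, j)|)
    (integrable_finsetSum _ fun j _ => integrable_finsetSum _ fun k _ =>
      ((integrable_eval_gaussPi (k, j)).const_mul _).abs) ?_ (Eventually.of_forall fun ω => ?_)
  · exact (Measurable.iInf fun x => by fun_prop).aestronglyMeasurable
  · have h0 : 0 ≤ ⨅ x, √(∑ j, (∑ k, z x k * ω (k, j)) ^ 2) :=
      Real.iInf_nonneg fun x => Real.sqrt_nonneg _
    rw [Real.norm_eq_abs, abs_of_nonneg h0]
    refine (ciInf_le (Set.finite_range _).bddBelow x₀).trans ?_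
    refine Real.sqrt_le_iff.2 ⟨by positivity, ?_⟩
    refine le_trans ?_ (Finset.sum_sq_le_sq_sum_of_nonneg fun j _ =>
      Finset.sum_nonneg fun k _ => abs_nonneg _)
    refine Finset.sum_le_sum fun j _ => ?_
    rw [← sq_abs]
    exact pow_le_pow_left₀ (abs_nonneg _) (Finset.abs_sum_le_sum_abs _ _) 2

theorem integral_comp_gaussPi {ι κ : Type*} [Fintype ι] [Fintype κ] {e : κ → ι}
    (he : Function.Injective e) {f : (κ → ℝ) → ℝ} (hf : Integrable f (gaussPi κ)) :
    ∫ ω, f (fun k => ω (e k)) ∂(gaussPi ι) = ∫ ω, f ω ∂(gaussPi κ) := by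
  have h := measurePreserving_comp_gaussPi he
  rw [← h.map_eq, integral_map h.measurable.aemeasurable
    (by rw [h.map_eq]; exact hf.aestronglyMeasurable)]

theorem expect_primalObj_eq (hm : 0 < m) (σ : ℝ) {s : EuclideanSpace ℝ (Fin n)} {c : ℝ}
    [Nonempty (OverlapSet s c)] :
    expect ((gaussMat m n).prod (gaussVec m)) (fun ω => primalObj σ s c ω.1 ω.2) =
      ((∫ ω, ⨅ x : OverlapSet s c, √(∑ j, (∑ k, augDiff σ s x.1 k * ω (k, j)) ^ 2)
        ∂(gaussPi (Option (Fin n) × Fin m)) : ℝ) : EReal) := by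
  have hI := integrable_iInf_sqrt (M := Fin m) fun x : OverlapSet s c => augDiff σ s x.1
  have hmp := measurePreserving_glueArray m n
  simp_rw [primalObj_eq hm]
  have hI' : Integrable (fun ω : (Fin m → Fin n → ℝ) × (Fin m → ℝ) => ⨅ x : OverlapSet s c,
      √(∑ j, (∑ k, augDiff σ s x.1 k * glueArray (ω.1, ω.2) (k, j)) ^ 2))
      ((gaussMat m n).prod (gaussVec m)) := hmp.integrable_comp_of_integrable hI
  rw [expect_coe hI', ← hmp.map_eq,
    integral_map hmp.measurable.aemeasurable (by rw [hmp.map_eq]; exact hI.aestronglyMeasurable)]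

theorem le_expect_primalObj (hm : 0 < m) (hn : 0 < n) (σ : ℝ) {s : EuclideanSpace ℝ (Fin n)}
    (hs : s ∈ binarySet n) (c ν : ℝ) [hne : Nonempty (OverlapSet s c)] :
    ((chiMean m * √(2 - 2 * c + σ ^ 2) - √(n : ℝ) * (∫ t, |t + ν| ∂(gaussianReal 0 1)) -
      √(n : ℝ) * ν * c : ℝ) : EReal) ≤
      expect ((gaussMat m n).prod (gaussVec m)) (fun ω => primalObj σ s c ω.1 ω.2) := by
  classical
  have hn0 : (0 : ℝ) < n := by exact_mod_cast hn
  have hn' : 0 < √(n : ℝ) := Real.sqrt_pos.2 hn0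
  have hnn : √(n : ℝ) * √(n : ℝ) = n := Real.mul_self_sqrt (Nat.cast_nonneg n)
  have := Fintype.ofFinite (OverlapSet s c)
  rw [expect_primalObj_eq hm, EReal.coe_le_coe_iff]
  set z : OverlapSet s c → Option (Fin n) → ℝ := fun x => augDiff σ s x.1 with hz
  set τ := √(2 - 2 * c + σ ^ 2) with hτ
  have hzτ : ∀ x, ∑ k, z x k ^ 2 = τ ^ 2 := by
    intro x
    have h := sum_augDiff_sq hn σ hs x.2.1
    rw [x.2.2] at h
    rw [hτ, Real.sq_sqrt (by rw [← h]; positivity)]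
    exact h
  have hI := integrable_iInf_sqrt (M := Fin m) z
  set J := (Option (Fin n) × Fin m) ⊕ (Fin m ⊕ Option (Fin n))
  set f : (J → ℝ) → ℝ := fun ω => τ * √(∑ j, ω (Sum.inr (Sum.inl j)) ^ 2) +
    ((∑ i, s i * ω (Sum.inr (Sum.inr (some i))) + σ * ω (Sum.inr (Sum.inr none))) -
      (1 / √(n : ℝ) * ∑ i, |ω (Sum.inr (Sum.inr (some i))) + √(n : ℝ) * -ν * s i| +
        √(n : ℝ) * ν * c)) with hf
  have f1 : Integrable (fun ω : J → ℝ => √(∑ j, ω (Sum.inr (Sum.inl j)) ^ 2)) (gaussPi J) :=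
    integrable_sqrt_sum_sq_gaussPi fun j => Sum.inr (Sum.inl j)
  have f2 : Integrable (fun ω : J → ℝ => ∑ i, s i * ω (Sum.inr (Sum.inr (some i)))) (gaussPi J) :=
    integrable_finsetSum _ fun i _ => (integrable_eval_gaussPi _).const_mul _
  have f3 : Integrable (fun ω : J → ℝ => σ * ω (Sum.inr (Sum.inr none))) (gaussPi J) :=
    (integrable_eval_gaussPi _).const_mul _
  have f4 : Integrable (fun ω : J → ℝ => ∑ i, |ω (Sum.inr (Sum.inr (some i))) +
      √(n : ℝ) * -ν * s i|) (gaussPi J) :=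
    integrable_sum_abs (fun i => √(n : ℝ) * -ν * s i) fun i => Sum.inr (Sum.inr (some i))
  have f5 := f2.fun_add f3
  have f6 := (f4.const_mul (1 / √(n : ℝ))).fun_add (integrable_const (√(n : ℝ) * ν * c))
  have f7 := f5.sub' f6
  have f8 := f1.const_mul τ
  have hfval : ∫ ω, f ω ∂(gaussPi J) = chiMean m * τ -
      √(n : ℝ) * (∫ t, |t + ν| ∂(gaussianReal 0 1)) - √(n : ℝ) * ν * c := by
    simp only [hf]
    rw [integral_add f8 f7, integral_sub f5 f6, integral_add f2 f3,
      integral_add (f4.const_mul _) (integrable_const _), integral_const_mul, integral_const_mul,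
      integral_const_mul, integral_const,
      integral_sum_mul_eval_gaussPi s.ofLp fun i => (Sum.inr (Sum.inr (some i)) : J),
      integral_sum_abs hn hs (-ν) fun i => (Sum.inr (Sum.inr (some i)) : J),
      integral_abs_add_neg,
      integral_eval_gaussPi (Sum.inr (Sum.inr none) : J) (f := fun t => t) measurable_id,
      integral_id_gaussianReal,
      integral_comp_gaussPi (e := fun j => (Sum.inr (Sum.inl j) : J))
        (f := fun g : Fin m → ℝ => √(∑ j, g j ^ 2))
        (fun a b h => Sum.inl_injective (Sum.inr_injective h))
        (integrable_sqrt_sum_sq_gaussPi fun j => j), ← chiMean]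
    simp only [probReal_univ, one_smul]
    generalize ∫ t, |t + ν| ∂(gaussianReal 0 1) = I
    clear_value τ
    clear f1 f2 f3 f4 f5 f6 f7 f8
    clear_value f
    generalize √(n : ℝ) = r at hn' hnn
    rw [← hnn]
    field_simp
    ring
  rw [← hfval, ← integral_comp_gaussPi (ι := J) (e := Sum.inl) Sum.inl_injective hI]
  refine gordon_min_le z (Real.sqrt_nonneg _) hzτ (f8.fun_add f7) ?_ (fun ω x => ?_) fun ω => ?_
  · exact (measurePreserving_comp_gaussPi (ι := J) (e := Sum.inl)
      Sum.inl_injective).integrable_comp_of_integrable hI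
  · have h1 := le_sum_mul_of_mem_binarySet x.2.1
      fun i => -(ω (Sum.inr (Sum.inr (some i))) + √(n : ℝ) * -ν * s i)
    simp only [abs_neg] at h1
    have h2 : ∑ i, x.1 i * -(ω (Sum.inr (Sum.inr (some i))) + √(n : ℝ) * -ν * s i) =
        √(n : ℝ) * ν * c - ∑ i, x.1 i * ω (Sum.inr (Sum.inr (some i))) := by
      have h0 : c = ∑ i, s i * x.1 i := by rw [← inner_eq_sum, x.2.2]
      have h4 : √(n : ℝ) * ν * c = √(n : ℝ) * ν * ∑ i, s i * x.1 i := congrArg _ h0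
      rw [h4, Finset.mul_sum, ← Finset.sum_sub_distrib]
      exact Finset.sum_congr rfl fun i _ => by ring
    have h3 : ∑ k, z x k * ω (Sum.inr (Sum.inr k)) = σ * ω (Sum.inr (Sum.inr none)) +
        (∑ i, s i * ω (Sum.inr (Sum.inr (some i))) -
          ∑ i, x.1 i * ω (Sum.inr (Sum.inr (some i)))) := by
      rw [Fintype.sum_option, ← Finset.sum_sub_distrib]
      simp [hz, augDiff, sub_mul]
    simp only [hf]
    rw [h3]
    linarith
  · obtain ⟨x, hx⟩ := exists_eq_ciInf_of_finite (f := fun x : OverlapSet s c =>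
      √(∑ j, (∑ k, z x k * ω (Sum.inl (k, j))) ^ 2))
    exact ⟨x, hx.le⟩

theorem le_primalMean (hm : 0 < m) (hn : 0 < n) (σ : ℝ) {s : EuclideanSpace ℝ (Fin n)}
    (hs : s ∈ binarySet n) (c ν : ℝ) :
    ((chiMean m / √(n : ℝ) * √(2 - 2 * c + σ ^ 2) - (∫ t, |t + ν| ∂(gaussianReal 0 1)) -
      ν * c : ℝ) : EReal) ≤ primalMean m n σ s c := by
  have hn' : 0 < √(n : ℝ) := Real.sqrt_pos.2 (by exact_mod_cast hn)
  unfold primalMean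
  rcases isEmpty_or_nonempty (OverlapSet s c) with h | h
  · have : IsProbabilityMeasure ((gaussMat m n).prod (gaussVec m)) := by
      unfold gaussMat gaussVec; infer_instance
    have h2 : (fun ω : (Fin m → Fin n → ℝ) × (Fin m → ℝ) => primalObj σ s c ω.1 ω.2) =
        fun _ => ⊤ :=
      funext fun ω => primalObj_eq_top hm σ (fun x hx hc => h.elim ⟨x, hx, hc⟩) _ _
    rw [h2, expect_top, EReal.coe_mul_top_of_pos (inv_pos.2 hn')]
    exact le_top
  · refine le_trans ?_ (mul_le_mul_of_nonneg_left (le_expect_primalObj hm hn σ hs c ν)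
      (EReal.coe_nonneg.2 (inv_nonneg.2 hn'.le)))
    rw [← EReal.coe_mul, EReal.coe_le_coe_iff]
    refine le_of_eq ?_
    generalize ∫ t, |t + ν| ∂(gaussianReal 0 1) = I
    field_simp

end Primal

theorem coe_mlBound_le {α σ c : ℝ} (hc : c ∈ Set.Icc (-1 : ℝ) 1) {L : EReal}
    (h : ∀ ν, ((xiRD α σ c ν : ℝ) : EReal) ≤ L) : ((mlBound α σ c : ℝ) : EReal) ≤ L := by
  by_contra! hlt
  obtain ⟨r, h1, h2⟩ := EReal.lt_iff_exists_real_btwn.1 hlt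
  obtain ⟨_, ⟨ν, rfl⟩, hν⟩ :=
    (lt_isLUB_iff (isLUB_range_xiRD α σ hc)).1 (EReal.coe_lt_coe_iff.1 h2)
  exact absurd ((h ν).trans_lt h1) (not_lt.2 (EReal.coe_le_coe_iff.2 hν.le))

theorem iSup_coe_xiRD (α σ : ℝ) {c : ℝ} (hc : c ∈ Set.Icc (-1 : ℝ) 1) :
    ⨆ ν : ℝ, ((xiRD α σ c ν : ℝ) : EReal) = ((mlBound α σ c : ℝ) : EReal) :=
  le_antisymm (iSup_le fun ν => EReal.coe_le_coe_iff.2 ((isLUB_range_xiRD α σ hc).1 ⟨ν, rfl⟩))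
    (coe_mlBound_le hc fun ν => le_iSup (fun ν => ((xiRD α σ c ν : ℝ) : EReal)) ν)

section Limits

variable {α σ : ℝ} {m : ℕ → ℕ} {s : ∀ n, EuclideanSpace ℝ (Fin n)}

theorem eventually_pos_pos (hα : 0 < α)
    (hm : Tendsto (fun n => (m n : ℝ) / (n : ℝ)) atTop (𝓝 α)) :
    ∀ᶠ n in atTop, 0 < m n ∧ 0 < n := by
  filter_upwards [hm.eventually (lt_mem_nhds hα), eventually_gt_atTop 0] with n hn h0
  refine ⟨Nat.pos_of_ne_zero fun h => ?_, h0⟩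
  simp [h] at hn

theorem tendsto_dual_value (hα : 0 < α)
    (hm : Tendsto (fun n => (m n : ℝ) / (n : ℝ)) atTop (𝓝 α)) {c : ℕ → ℝ} {c₁ : ℝ}
    (hc : Tendsto c atTop (𝓝 c₁)) (ν : ℝ) :
    Tendsto (fun n : ℕ => ((chiMean (m n) / √(n : ℝ) * √(2 - 2 * c n + σ ^ 2) -
      (∫ t, |t + ν| ∂(gaussianReal 0 1)) - ν * c n : ℝ) : EReal)) atTop
      (𝓝 ((xiRD α σ c₁ ν : ℝ) : EReal)) := by
  refine (continuous_coe_real_ereal.tendsto _).comp ?_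
  have h1 : Tendsto (fun n => √(2 - 2 * c n + σ ^ 2)) atTop (𝓝 √(2 - 2 * c₁ + σ ^ 2)) :=
    ((continuous_const.sub (continuous_const.mul continuous_id)).add continuous_const).sqrt.tendsto
      c₁ |>.comp hc
  exact (((tendsto_chiMean_div_sqrt hα hm).mul h1).sub_const _).sub (hc.const_mul ν)

theorem mlBound_le_xiPrimal (hα : 0 < α)
    (hm : Tendsto (fun n => (m n : ℝ) / (n : ℝ)) atTop (𝓝 α)) (hs : ∀ n, s n ∈ binarySet n)
    {c₁ : ℝ} (hc₁ : c₁ ∈ Set.Icc (-1 : ℝ) 1) {c : ℕ → ℝ} (hc : Tendsto c atTop (𝓝 c₁)) :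
    ((mlBound α σ c₁ : ℝ) : EReal) ≤ xiPrimal σ m s c := by
  refine coe_mlBound_le hc₁ fun ν => ?_
  rw [← (tendsto_dual_value (σ := σ) hα hm hc ν).liminf_eq]
  refine liminf_le_liminf ?_
  filter_upwards [eventually_pos_pos hα hm] with n hn
  exact le_primalMean hn.1 hn.2 σ (hs n) (c n) ν

theorem limsup_dualMeanFree_le (hα : 0 < α)
    (hm : Tendsto (fun n => (m n : ℝ) / (n : ℝ)) atTop (𝓝 α)) (hs : ∀ n, s n ∈ binarySet n)
    {c₁ : ℝ} (hc₁ : c₁ ∈ Set.Icc (-1 : ℝ) 1) (ν : ℝ) :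
    limsup (fun n => dualMeanFree (m n) n σ (s n) c₁ ν) atTop ≤
      ((mlBound α σ c₁ : ℝ) : EReal) := by
  have h : Tendsto (fun n : ℕ => ((chiMean (m n) / √(n : ℝ) * √(2 - 2 * c₁ + σ ^ 2) +
      (mlBound α σ c₁ - √α * √(2 - 2 * c₁ + σ ^ 2)) : ℝ) : EReal)) atTop
      (𝓝 ((mlBound α σ c₁ : ℝ) : EReal)) := by
    refine (continuous_coe_real_ereal.tendsto _).comp ?_
    have h1 := ((tendsto_chiMean_div_sqrt hα hm).mul_const √(2 - 2 * c₁ + σ ^ 2)).add_const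
      (mlBound α σ c₁ - √α * √(2 - 2 * c₁ + σ ^ 2))
    rwa [add_sub_cancel] at h1
  rw [← h.limsup_eq]
  refine limsup_le_limsup ?_
  filter_upwards [eventually_pos_pos hα hm] with n hn
  exact dualMeanFree_le_mlBound hn.1 hn.2 α σ (hs n) hc₁ ν

end Limits

end MLDetection

end

theorem theorem2 (α σ : ℝ) (hα : 0 < α)
    (m : ℕ → ℕ) (hm : Tendsto (fun n => (m n : ℝ) / (n : ℝ)) atTop (𝓝 α))
    (s : ∀ n, EuclideanSpace ℝ (Fin n)) (hs : ∀ n, s n ∈ MLDetection.binarySet n) :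
    (∀ c₁ ∈ Set.Icc (-1 : ℝ) 1,
      -- `ξ_RD` is the limit of the random dual
      (∀ ν : ℝ, Tendsto (fun n => MLDetection.dualMeanFixed (m n) n σ (s n) c₁ ν) atTop
        (𝓝 ((MLDetection.xiRD α σ c₁ ν : ℝ) : EReal))) ∧
      -- its maximum over `ν` (a supremum for `c₁ = ±1`)
      IsLUB (Set.range (MLDetection.xiRD α σ c₁)) (MLDetection.mlBound α σ c₁) ∧
      (c₁ ∈ Set.Ioo (-1 : ℝ) 1 →
        IsGreatest (Set.range (MLDetection.xiRD α σ c₁)) (MLDetection.mlBound α σ c₁)) ∧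
      -- the lower bound on `ξ_p`
      ((MLDetection.mlBound α σ c₁ : ℝ) : EReal) ≤ MLDetection.xiPrimal σ m s (fun _ => c₁) ∧
      (∀ c : ℕ → ℝ, Tendsto c atTop (𝓝 c₁) →
        ((MLDetection.mlBound α σ c₁ : ℝ) : EReal) ≤ MLDetection.xiPrimal σ m s c) ∧
      -- the random dual that keeps `‖s - x‖` inside the minimum gives a lower bound as well
      (∀ ν : ℝ, limsup (fun n => MLDetection.dualMeanFree (m n) n σ (s n) c₁ ν) atTop
        ≤ ((MLDetection.mlBound α σ c₁ : ℝ) : EReal))) ∧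
    -- minimization over the overlap
    (∃ c₀ ∈ Set.Icc (-1 : ℝ) 1,
      IsMinOn (MLDetection.mlBound α σ) (Set.Icc (-1 : ℝ) 1) c₀ ∧
      (⨅ c₁ ∈ Set.Icc (-1 : ℝ) 1, ⨆ ν : ℝ, ((MLDetection.xiRD α σ c₁ ν : ℝ) : EReal))
        = ((MLDetection.mlBound α σ c₀ : ℝ) : EReal) ∧
      ((MLDetection.mlBound α σ c₀ : ℝ) : EReal)
        ≤ ⨅ c₁ ∈ Set.Icc (-1 : ℝ) 1, MLDetection.xiPrimal σ m s (fun _ => c₁)) := by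
  refine ⟨fun c₁ hc₁ => ⟨fun ν => ?_, MLDetection.isLUB_range_xiRD α σ hc₁,
    fun hc => MLDetection.isGreatest_range_xiRD α σ hc,
    MLDetection.mlBound_le_xiPrimal hα hm hs hc₁ tendsto_const_nhds,
    fun c hc => MLDetection.mlBound_le_xiPrimal hα hm hs hc₁ hc,
    fun ν => MLDetection.limsup_dualMeanFree_le hα hm hs hc₁ ν⟩, ?_⟩
  · refine (MLDetection.tendsto_dual_value (σ := σ) hα hm (tendsto_const_nhds (x := c₁)) ν).congr' ?_
    filter_upwards [MLDetection.eventually_pos_pos hα hm] with n hn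
    exact (MLDetection.dualMeanFixed_eq hn.1 hn.2 σ (hs n) c₁ ν).symm
  · obtain ⟨c₀, hc₀, hmin⟩ := MLDetection.exists_isMinOn_mlBound α σ
    refine ⟨c₀, hc₀, hmin, ?_, ?_⟩
    · refine (iInf_congr fun c => iInf_congr fun hc =>
        MLDetection.iSup_coe_xiRD α σ (c := c) hc).trans ?_
      exact le_antisymm (iInf₂_le c₀ hc₀)
        (le_iInf₂ fun c hc => EReal.coe_le_coe_iff.2 (hmin hc))
    · exact le_iInf₂ fun c hc => (EReal.coe_le_coe_iff.2 (hmin hc)).trans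
        (MLDetection.mlBound_le_xiPrimal hα hm hs hc tendsto_const_nhds)
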